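/- **Conventions.** Let $P$ be a finite graded poset with least element $\hat 0$, greatest element $\hat 1$, rank function $\mathrm{rk}$ and rank $n+1$, where $n\ge 1$. For $S=\{\ell_1<\dots<\ell_k\}\subseteq[n]=\{1,\dots,n\}$ let $f_S(P)$ be the number of chains $x_1<\dots<x_k$ in $P$ with $\mathrm{rk}(x_j)=\ell_j$. Put $\chi(P)=\sum_{j=1}^n(-1)^{j-1}f_{\{j\}}(P)$ and $\chi(\mathbb S^{n-1})=1-(-1)^n$. Let $f'_S(P)=f_S(P)$ for $S\ne\{n\}$ and $f'_{\{n\}}(P)=f_{\{n\}}(P)+\chi(\mathbb S^{n-1})-\chi(P)$. In non-commuting variables $a,b$ let $\chi'_P(a,b)=\sum_{S\subseteq[n]}f'_S(P)\,u_S$, where $u_S=u_1\cdots u_n$ with $u_i=b$ if $i\in S$ and $u_i=a$ if $i\notin S$. The $cd$-index of $P$ is the polynomial $\Phi_P(c,d)$ with integer coefficients in non-commuting variables $c,d$ that satisfies $\Phi_P(a+b,ab+ba)=\chi'_P(a-b,b)$, if there is a unique such polynomial. $P$ is *semi-Eulerian* if every interval $[s,t]\ne P$ with more than one element has as many elements of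 odd rank as of even rank, and *simplicial* if $[\hat 0,x]$ is isomorphic to a Boolean algebra for every $x\neq\hat 1$. For simplicial $P$ let $f_{i-1}(P)$ be the number of $x\in P$ such that $[\hat 0,x]$ is isomorphic to the Boolean algebra of rank $i$, and define $h_0(P),\dots,h_n(P)$ by $\sum_{i=0}^n f_{i-1}(P)(x-1)^{n-i}=\sum_{i=0}^n h_i(P)x^{n-i}$. Let $\sigma_0,\dots,\sigma_n$ be the facets of the boundary of an $n$-simplex. For $0\le i\le n-1$ let $\Gamma^n_i$ be the simplicial complex generated by $\sigma_0,\dots,\sigma_i$, which is an $(n-1)$-ball, and let $\Lambda^n_i$ be its semisuspension, that is, the CW complex obtained from $\Gamma^n_i$ by attaching one new $(n-1)$-cell along $\partial\Gamma^n_i$. Write $\Phi_{\Lambda^n_i}$ for the $cd$-index of the face poset of $\Lambda^n_i$ (with the empty face included) with a greatest element adjoined. Put $\check\Phi^n_0=\Phi_{\Lambda^n_0}$ and $\check\Phi^n_i=\Phi_{\Lambda^n_i}-\Phi_{\Lambda^n_{i-1}}$ for $1\le i\le n-1$. **Theorem.** Let $n\ge 1$ and let $P$ be a semi-Eulerian simplicial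 poset of rank $n+1$. Then the $cd$-indices $\Phi_P$ and $\Phi_{\Lambda^n_i}$, $0\le i\le n-1$, exist and are unique, and $$\Phi_P(c,d)=\sum_{i=0}^{n-1}h_i(P)\,\check\Phi^n_i(c,d).$$ -/

import Mathlib

/-! ### Flag vectors and the cd-index of a graded poset -/

/-- The two letters `a`, `b`. -/
inductive ABVar
  | a
  | b

/-- The two letters `c`, `d`. -/
inductive CDVar
  | c
  | d

/-- Integer polynomials in the non-commuting variables `a`, `b`. -/
abbrev ABPoly : Type := FreeAlgebra ℤ ABVar

/-- Integer polynomials in the non-commuting variables `c`, `d`. -/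
abbrev CDPoly : Type := FreeAlgebra ℤ CDVar

/-- The variable `a`. -/
def polyA : ABPoly := FreeAlgebra.ι ℤ ABVar.a

/-- The variable `b`. -/
def polyB : ABPoly := FreeAlgebra.ι ℤ ABVar.b

/-- The substitution `p(a, b) ↦ p(a - b, b)`. -/
def substAB : ABPoly →ₐ[ℤ] ABPoly :=
  FreeAlgebra.lift ℤ fun
    | ABVar.a => polyA - polyB
    | ABVar.b => polyB

/-- The substitution `q(c, d) ↦ q(a + b, ab + ba)`. -/
def substCD : CDPoly →ₐ[ℤ] ABPoly :=
  FreeAlgebra.lift ℤ fun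
    | CDVar.c => polyA + polyB
    | CDVar.d => polyA * polyB + polyB * polyA

/-- The monomial `u_S = u_1 u_2 ⋯ u_n` with `u_i = b` if `i ∈ S` and `u_i = a` if `i ∉ S`. -/
def monomialU (n : ℕ) (S : Finset ℕ) : ABPoly :=
  ((List.range n).map fun i => if i + 1 ∈ S then polyB else polyA).prod

section Graded

variable (n : ℕ) (P : Type*) [PartialOrder P] [GradeMinOrder ℕ P]

/-- The flag `f`-number `f_S(P)`: the number of chains `x_1 < ⋯ < x_k` of `P` whose elements have
exactly the ranks in `S = {ℓ_1 < ⋯ < ℓ_k}`, that is, `rk (x_j) = ℓ_j`. For `P` bounded of rank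
`n + 1` and `S ⊆ {1, …, n}` such chains automatically avoid the least and the greatest element. -/
noncomputable def flagF (S : Finset ℕ) : ℕ :=
  Nat.card {x : S → P // StrictMono x ∧ ∀ l : S, grade ℕ (x l) = (l : ℕ)}

/-- The Euler characteristic `χ(P) = ∑_{j=1}^n (-1)^(j-1) f_{j}(P)` of a poset of rank `n + 1`. -/
noncomputable def eulerChar : ℤ :=
  ∑ j ∈ Finset.Icc 1 n, (-1) ^ (j - 1) * (flagF P {j} : ℤ)

/-- The modified flag `f`-number `f'_S(P)`: it is `f_S(P)`, except for `S = {n}`, where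
`χ(𝕊^(n-1)) - χ(P)` is added; here `χ(𝕊^(n-1)) = 1 - (-1)^n`. -/
noncomputable def modifiedFlagF (S : Finset ℕ) : ℤ :=
  if S = {n} then (flagF P {n} : ℤ) + ((1 - (-1) ^ n) - eulerChar n P) else (flagF P S : ℤ)

/-- The modified chain polynomial `χ'_P(a, b) = ∑_{S ⊆ {1, …, n}} f'_S(P) u_S`. -/
noncomputable def modifiedChainPoly : ABPoly :=
  ∑ S ∈ (Finset.Icc 1 n).powerset, modifiedFlagF n P S • monomialU n S

/-- `Φ` is a `cd`-index of the poset `P` of rank `n + 1`: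
`Φ(a + b, ab + ba) = χ'_P(a - b, b)`. -/
def IsCDIndex (Φ : CDPoly) : Prop :=
  substCD Φ = substAB (modifiedChainPoly n P)

open Classical in
/-- The `cd`-index `Φ_P(c, d)` of a poset `P` of rank `n + 1` (and `0` if there is none). -/
noncomputable def cdIndex : CDPoly :=
  if h : ∃ Φ, IsCDIndex n P Φ then h.choose else 0

end Graded

/-! ### Semi-Eulerian posets, simplicial posets, `h`-vectors -/

/-- Every interval `[s, t]` with more than one element, other than the whole poset, has as many
elements of odd rank as of even rank. -/
def IsSemiEulerian (P : Type*) [PartialOrder P] [BoundedOrder P] [GradeMinOrder ℕ P] : Prop :=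
  ∀ s t : P, s < t → ¬ (s = ⊥ ∧ t = ⊤) →
    Nat.card {x : P // x ∈ Set.Icc s t ∧ Odd (grade ℕ x)} =
      Nat.card {x : P // x ∈ Set.Icc s t ∧ Even (grade ℕ x)}

/-- The lower interval below `x` is isomorphic to the Boolean algebra of rank `k`. -/
def IsBooleanBelow {P : Type*} [PartialOrder P] [OrderBot P] (x : P) (k : ℕ) : Prop :=
  Nonempty (Set.Icc ⊥ x ≃o Finset (Fin k))

/-- A poset is simplicial if all lower intervals `[⊥, x]` with `x ≠ ⊤` are Boolean algebras. -/
def IsSimplicialPoset (P : Type*) [PartialOrder P] [BoundedOrder P] : Prop :=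
  ∀ x : P, x ≠ ⊤ → ∃ k, IsBooleanBelow x k

/-- `faceNumber P i` is `f_{i-1}(P)`, the number of elements `x` of `P` such that `[⊥, x]` is a
Boolean algebra of rank `i`. -/
noncomputable def faceNumber (P : Type*) [PartialOrder P] [OrderBot P] (i : ℕ) : ℕ :=
  Nat.card {x : P // IsBooleanBelow x i}

open Polynomial in
/-- The `h`-number `h_i(P)` of a poset of rank `n + 1`, for `i ≤ n`: the coefficient of `x^(n-i)`
in `∑_{j=0}^n f_{j-1}(P) (x - 1)^(n-j)`. -/
noncomputable def hNumber (n : ℕ) (P : Type*) [PartialOrder P] [OrderBot P] (i : ℕ) : ℤ :=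
  (∑ j ∈ Finset.range (n + 1), C (faceNumber P j : ℤ) * (X - 1) ^ (n - j) : ℤ[X]).coeff (n - i)

/-! ### Semisuspensions

An abstract simplicial complex on the vertex set `V`, with the empty face included, is a lower set
of `Finset V`. -/

/-- The boundary complex of a pure simplicial complex which is a ball: it is generated by the
faces `R` of codimension one that lie in exactly one facet. -/
def boundaryComplex {V : Type*} (Γ : LowerSet (Finset V)) : LowerSet (Finset V) :=
  lowerClosure {R | ∃! F, Maximal (· ∈ Γ) F ∧ R ⋖ F}

/-- The face poset, with a greatest element `top` adjoined, of the semisuspension of `Γ`: to the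
faces of `Γ` one new cell is added, and the proper faces of this cell are the faces of the boundary
complex of `Γ`. -/
inductive Semisuspension {V : Type*} (Γ : LowerSet (Finset V)) : Type _
  | face (F : Finset V) (hF : F ∈ Γ)
  | cell
  | top

namespace Semisuspension

variable {V : Type*} {Γ : LowerSet (Finset V)}

/-- The order: inclusion of faces; the faces below the new cell are those of the boundary. -/
protected def le : Semisuspension Γ → Semisuspension Γ → Prop
  | face F _, face G _ => F ⊆ G
  | face F _, cell => F ∈ boundaryComplex Γ
  | cell, face _ _ => False
  | cell, cell => True
  | top, face _ _ => False
  | top, cell => False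
  | _, top => True

instance : PartialOrder (Semisuspension Γ) where
  le := Semisuspension.le
  le_refl x := by cases x <;> simp [Semisuspension.le]
  le_trans x y z := by
    cases x <;> cases y <;> cases z <;> simp only [Semisuspension.le] <;>
      first
        | tauto
        | exact fun h₁ h₂ => h₁.trans h₂
        | exact fun h₁ h₂ => (boundaryComplex Γ).lower h₁ h₂
  le_antisymm x y := by
    cases x <;> cases y <;> simp only [Semisuspension.le] <;>
      first
        | tauto
        | (intro h₁ h₂; congr; exact h₁.antisymm h₂)

theorem face_le_face {F G : Finset V} {hF : F ∈ Γ} {hG : G ∈ Γ} :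
    face F hF ≤ face G hG ↔ F ⊆ G := Iff.rfl

theorem face_le_cell {F : Finset V} {hF : F ∈ Γ} :
    face F hF ≤ cell ↔ F ∈ boundaryComplex Γ := Iff.rfl

theorem not_cell_le_face {F : Finset V} {hF : F ∈ Γ} : ¬ cell ≤ face F hF := fun h => h

theorem not_top_le_face {F : Finset V} {hF : F ∈ Γ} : ¬ top ≤ face F hF := fun h => h

theorem not_top_le_cell : ¬ (top : Semisuspension Γ) ≤ cell := fun h => h

theorem le_top' (x : Semisuspension Γ) : x ≤ top := by cases x <;> trivial

theorem face_lt_face {F G : Finset V} {hF : F ∈ Γ} {hG : G ∈ Γ} :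
    face F hF < face G hG ↔ F ⊂ G := by
  rw [lt_iff_le_not_ge, face_le_face, face_le_face]; rfl

theorem face_lt_cell {F : Finset V} {hF : F ∈ Γ} :
    face F hF < cell ↔ F ∈ boundaryComplex Γ := by
  rw [lt_iff_le_not_ge, face_le_cell]; simp [not_cell_le_face]

theorem face_lt_top {F : Finset V} {hF : F ∈ Γ} : face F hF < top :=
  lt_iff_le_not_ge.2 ⟨le_top' _, not_top_le_face⟩

instance [Finite V] : Finite (Semisuspension Γ) := by
  refine Finite.of_injective (β := Option (Option (Finset V)))
    (fun | face F _ => some (some F) | cell => some none | top => none) ?_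
  intro x y h
  cases x <;> cases y <;> simp_all

theorem cell_lt_top : (cell : Semisuspension Γ) < top :=
  lt_iff_le_not_ge.2 ⟨le_top' _, not_top_le_cell⟩

end Semisuspension

/-! ### Partial shellings of the boundary of a simplex -/

/-- The facet `σ_j` of the boundary `Λ^n` of the simplex on the vertices `0, …, n`: all vertices
but `j`. -/
def simplexFacet (n : ℕ) (j : Fin (n + 1)) : Finset (Fin (n + 1)) := Finset.univ.erase j

/-- The complex `Γ^n_i` generated by the facets `σ_0, …, σ_i` of `Λ^n`. -/
def partialShelling (n : ℕ) (i : Fin n) : LowerSet (Finset (Fin (n + 1))) :=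
  lowerClosure {F | ∃ j : Fin (n + 1), (j : ℕ) ≤ i ∧ F = simplexFacet n j}

/-- The augmented face poset of `Λ^n_i`, the semisuspension of `Γ^n_i`. -/
abbrev LambdaPoset (n : ℕ) (i : Fin n) : Type := Semisuspension (partialShelling n i)

section LambdaPoset

variable {n : ℕ} {i : Fin n} {F : Finset (Fin (n + 1))}

theorem mem_partialShelling :
    F ∈ partialShelling n i ↔ ∃ j : Fin (n + 1), (j : ℕ) ≤ i ∧ j ∉ F := by
  constructor
  · rintro ⟨_, ⟨j, hj, rfl⟩, hF⟩
    exact ⟨j, hj, fun h => by simpa [simplexFacet] using hF h⟩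
  · rintro ⟨j, hj, hF⟩
    exact ⟨_, ⟨j, hj, rfl⟩, fun x hx => by
      simp only [simplexFacet, Finset.mem_erase, Finset.mem_univ, and_true]
      rintro rfl; exact hF hx⟩

theorem subset_simplexFacet {j : Fin (n + 1)} : F ⊆ simplexFacet n j ↔ j ∉ F := by
  simp [simplexFacet, Finset.subset_erase]

theorem simplexFacet_mem {j : Fin (n + 1)} (hj : (j : ℕ) ≤ i) :
    simplexFacet n j ∈ partialShelling n i :=
  mem_partialShelling.2 ⟨j, hj, by simp [simplexFacet]⟩

theorem card_simplexFacet (j : Fin (n + 1)) : (simplexFacet n j).card = n := by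
  simp [simplexFacet]

theorem maximal_partialShelling :
    Maximal (· ∈ partialShelling n i) F ↔ ∃ j : Fin (n + 1), (j : ℕ) ≤ i ∧ F = simplexFacet n j := by
  constructor
  · intro h
    obtain ⟨j, hj, hF⟩ := mem_partialShelling.1 h.prop
    exact ⟨j, hj, h.eq_of_le (simplexFacet_mem hj) (subset_simplexFacet.2 hF)⟩
  · rintro ⟨j, hj, rfl⟩
    refine ⟨simplexFacet_mem hj, fun G hG hle => ?_⟩
    obtain ⟨k, -, hk⟩ := mem_partialShelling.1 hG
    have hkG : G ⊆ simplexFacet n k := subset_simplexFacet.2 hk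
    have hc : (simplexFacet n k).card ≤ (simplexFacet n j).card := by
      rw [card_simplexFacet, card_simplexFacet]
    exact hkG.trans (Finset.eq_of_subset_of_card_le (hle.trans hkG) hc).ge

theorem mem_boundary_partialShelling :
    F ∈ boundaryComplex (partialShelling n i) ↔
      ∃ j k : Fin (n + 1), (j : ℕ) ≤ i ∧ (i : ℕ) < k ∧ j ∉ F ∧ k ∉ F := by
  constructor
  · rintro ⟨R, ⟨G, ⟨hG, hRG⟩, huniq⟩, hFR⟩
    obtain ⟨j, hj, rfl⟩ := maximal_partialShelling.1 hG
    obtain ⟨k, hkG, hkR⟩ := Finset.exists_of_ssubset hRG.lt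
    have hjR : j ∉ R := subset_simplexFacet.1 hRG.le
    refine ⟨j, k, hj, ?_, fun h => hjR (hFR h), fun h => hkR (hFR h)⟩
    by_contra hki
    have hkj : simplexFacet n k = simplexFacet n j := by
      refine huniq _ ⟨maximal_partialShelling.2 ⟨k, not_lt.1 hki, rfl⟩, ?_⟩
      rw [Finset.covBy_iff_card_sdiff_eq_one] at hRG ⊢
      refine ⟨subset_simplexFacet.2 hkR, ?_⟩
      have h1 := Finset.card_sdiff_add_card_eq_card hRG.1
      have h2 := Finset.card_sdiff_add_card_eq_card (subset_simplexFacet.2 hkR)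
      rw [card_simplexFacet] at h1 h2
      omega
    rw [← hkj] at hkG
    simp [simplexFacet] at hkG
  · rintro ⟨j, k, hj, hk, hjF, hkF⟩
    have hjk : j ≠ k := by rintro rfl; omega
    refine ⟨(simplexFacet n j).erase k, ⟨simplexFacet n j,
      ⟨maximal_partialShelling.2 ⟨j, hj, rfl⟩, Finset.erase_covBy ?_⟩, ?_⟩, ?_⟩
    · simp [simplexFacet, hjk.symm]
    · rintro G ⟨hG, hcov⟩
      obtain ⟨l, hl, rfl⟩ := maximal_partialShelling.1 hG
      have hlR := subset_simplexFacet.1 hcov.le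
      have : l = k ∨ l = j := by
        by_contra hne
        push Not at hne
        exact hlR (by simp [simplexFacet, hne.1, hne.2])
      rcases this with rfl | rfl
      · omega
      · rfl
    · intro x hx
      simp only [simplexFacet, Finset.mem_erase, Finset.mem_univ, and_true]
      exact ⟨by rintro rfl; exact hkF hx, by rintro rfl; exact hjF hx⟩

namespace LambdaPoset

open Semisuspension

/-- The rank function of the augmented face poset of `Λ^n_i`. -/
def rank : LambdaPoset n i → ℕ
  | face F _ => F.card
  | cell => n
  | top => n + 1

theorem card_le_of_mem (hF : F ∈ partialShelling n i) : F.card ≤ n := by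
  obtain ⟨j, -, hjF⟩ := mem_partialShelling.1 hF
  exact (Finset.card_le_card (subset_simplexFacet.2 hjF)).trans_eq (card_simplexFacet j)

theorem card_lt_of_mem_boundary (hF : F ∈ boundaryComplex (partialShelling n i)) :
    F.card < n := by
  obtain ⟨j, k, hj, hk, hjF, hkF⟩ := mem_boundary_partialShelling.1 hF
  refine (Finset.card_lt_card ⟨subset_simplexFacet.2 hjF, fun h => hkF (h ?_)⟩).trans_eq
    (card_simplexFacet j)
  simp only [simplexFacet, Finset.mem_erase, Finset.mem_univ, and_true]
  rintro rfl; omega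

theorem empty_mem_boundary : (∅ : Finset (Fin (n + 1))) ∈ boundaryComplex (partialShelling n i) :=
  mem_boundary_partialShelling.2 ⟨0, Fin.last n, by simp, by simp, by simp, by simp⟩

theorem empty_mem : (∅ : Finset (Fin (n + 1))) ∈ partialShelling n i :=
  mem_partialShelling.2 ⟨0, by simp, by simp⟩

instance : BoundedOrder (LambdaPoset n i) where
  top := top
  le_top := le_top'
  bot := face ∅ empty_mem
  bot_le x := by
    cases x with
    | face F hF => exact face_le_face.2 (Finset.empty_subset F)
    | cell => exact face_le_cell.2 empty_mem_boundary
    | top => exact le_top' _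

theorem rank_strictMono : StrictMono (rank : LambdaPoset n i → ℕ) := by
  intro x y hxy
  cases x with
  | face F hF =>
    cases y with
    | face G hG => exact Finset.card_lt_card (face_lt_face.1 hxy)
    | cell => exact card_lt_of_mem_boundary (face_lt_cell.1 hxy)
    | top => exact Nat.lt_succ_of_le (card_le_of_mem hF)
  | cell =>
    cases y with
    | face G hG => exact (not_cell_le_face hxy.le).elim
    | cell => exact (lt_irrefl _ hxy).elim
    | top => exact Nat.lt_succ_self n
  | top => exact ((le_top' y).not_gt hxy).elim

theorem rank_covBy {x y : LambdaPoset n i} (hxy : x ⋖ y) : rank y = rank x + 1 := by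
  cases x with
  | face F hF =>
    cases y with
    | face G hG =>
      have h : F ⋖ G := ⟨face_lt_face.1 hxy.lt, fun H h₁ h₂ =>
        hxy.2 (c := face H ((partialShelling n i).lower h₂.le hG))
          (face_lt_face.2 h₁) (face_lt_face.2 h₂)⟩
      exact (Nat.covBy_iff_add_one_eq.1 (h.grade ℕ)).symm
    | cell =>
      obtain ⟨j, k, hj, hk, hjF, hkF⟩ := mem_boundary_partialShelling.1 (face_lt_cell.1 hxy.lt)
      have hjk : k ≠ j := by rintro rfl; omega
      have hR : (simplexFacet n j).erase k ∈ boundaryComplex (partialShelling n i) :=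
        mem_boundary_partialShelling.2 ⟨j, k, hj, hk, by simp [simplexFacet], by simp⟩
      have hR' : (simplexFacet n j).erase k ∈ partialShelling n i :=
        mem_partialShelling.2 ⟨j, hj, by simp [simplexFacet]⟩
      have hFR : F ⊆ (simplexFacet n j).erase k :=
        Finset.subset_erase.2 ⟨subset_simplexFacet.2 hjF, hkF⟩
      have hEq : F = (simplexFacet n j).erase k := by
        by_contra hne
        exact hxy.2 (c := face _ hR') (face_lt_face.2 (hFR.ssubset_of_ne hne))
          (face_lt_cell.2 hR)
      have hc := Finset.card_erase_of_mem (s := simplexFacet n j) (a := k)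
        (by simp [simplexFacet, hjk])
      rw [card_simplexFacet] at hc
      have hn := i.pos
      simp only [rank, hEq, hc]
      omega
    | top =>
      obtain ⟨j, hj, hjF⟩ := mem_partialShelling.1 hF
      have hEq : F = simplexFacet n j := by
        by_contra hne
        exact hxy.2 (c := face _ (simplexFacet_mem hj))
          (face_lt_face.2 ((subset_simplexFacet.2 hjF).ssubset_of_ne hne)) face_lt_top
      simp only [rank, hEq, card_simplexFacet]
  | cell =>
    cases y with
    | face G hG => exact (not_cell_le_face hxy.le).elim
    | cell => exact (lt_irrefl _ hxy.lt).elim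
    | top => rfl
  | top => exact ((le_top' y).not_gt hxy.lt).elim

instance : GradeMinOrder ℕ (LambdaPoset n i) where
  grade := rank
  grade_strictMono := rank_strictMono
  covBy_grade _ _ h := Nat.covBy_iff_add_one_eq.2 (rank_covBy h).symm
  isMin_grade x hx := by
    have hx' : x = ⊥ := hx.eq_bot
    subst hx'
    exact isMin_bot

theorem grade_top_eq : grade ℕ (⊤ : LambdaPoset n i) = n + 1 := rfl

end LambdaPoset

end LambdaPoset

/-- Stanley's polynomials `Φ̌^n_i`: `Φ̌^n_0` is the `cd`-index of `Λ^n_0`, for `0 < i < n` the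
polynomial `Φ̌^n_i` is the difference of the `cd`-indices of `Λ^n_i` and `Λ^n_{i-1}`, and
`Φ̌^n_n = 0`. -/
noncomputable def checkPhi (n : ℕ) : ℕ → CDPoly
  | 0 => if h : 0 < n then cdIndex n (LambdaPoset n ⟨0, h⟩) else 0
  | i + 1 =>
    if h : i + 1 < n then
      cdIndex n (LambdaPoset n ⟨i + 1, h⟩) - cdIndex n (LambdaPoset n ⟨i, Nat.lt_of_succ_lt h⟩)
    else 0

/-! Put `z = a - b`. Grouping chains by their greatest element turns the chain polynomial at `(a -
b, b)` into a sum over `x < ⊤` of a weight of `x` times `z ^ (n - rk x)`. In a simplicial poset `[⊥,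
x]` is Boolean, so this weight is a number-like quantity `w_j` depending only on `j = rk x`. Hence
the chain polynomial is `L_{n+1}(F)`, where `F = ∑_{x < ⊤} X ^ rk x` and the linear functional `L_m`
(`umbral` of `faceTerm`) sends `X ^ j` to `w_j z ^ (m-1-j)` for `j < m` and to `0` otherwise.

The h-numbers are the coordinates of `F` with respect to the polynomials `X^i (1+X)^(n-i)`. The
Dehn-Sommerville relations give `∑ h_i X^(n-i) (1+X)^i = F - e`, where `e = χ(𝕊^(n-1)) - χ(P)` is
exactly the correction in `f'_{n}`. Set `Ψ_i = L_{n+1}(X^i (1+X)^(n-i)) + L_n(X^i (1+X)^(n-i)) b -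
L_n(X^(n-i) (1+X)^i) b` (`checkPsi_eq`). Then `∑ h_i Ψ_i = L_{n+1}(F) + L_n(e) b`, which is the
ab-polynomial of `P`; moreover `Ψ_n = 0`.

The faces and boundary faces of `Γ^n_i` have explicit generating polynomials. Taking differences for
consecutive `i` shows that `Ψ_i` is the ab-polynomial of `checkPhi n i`. A recursion in `n` writes
`Ψ_i` in terms of `a + b` and `ab + ba` (`checkPsi_mem`), which gives existence of all the
cd-indices. Uniqueness is the injectivity of `substCD`, proved with right derivatives. -/

open Polynomial in
/-- The linear functional on polynomials with values `g j` on `X ^ j`. -/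
noncomputable def umbral {R : Type*} [Ring R] (g : ℕ → R) : ℤ[X] →ₗ[ℤ] R :=
  Polynomial.lsum fun j => LinearMap.toSpanSingleton ℤ R (g j)

/-! ### Boolean weights and the cd-recursion for `checkPsi` -/

section Algebra

variable {R : Type*} [Ring R]

open Polynomial

theorem umbral_apply (g : ℕ → R) (p : ℤ[X]) : umbral g p = p.sum fun j k => k • g j := by
  simp [umbral, Polynomial.lsum_apply, LinearMap.toSpanSingleton_apply]

theorem umbral_X_pow (g : ℕ → R) (j : ℕ) : umbral g (X ^ j) = g j := by
  rw [umbral_apply, ← Polynomial.monomial_one_right_eq_X_pow, Polynomial.sum_monomial_index] <;> simp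

theorem umbral_one_add_X_pow (g : ℕ → R) (n : ℕ) :
    umbral g ((1 + X) ^ n) = ∑ j ∈ Finset.range (n + 1), n.choose j • g j := by
  rw [add_comm, add_pow, map_sum]
  refine Finset.sum_congr rfl fun j _ => ?_
  rw [one_pow, mul_one, mul_comm, ← nsmul_eq_mul, map_nsmul, umbral_X_pow]

/-- The weight of the top element of a Boolean algebra of rank `n`. -/
noncomputable def boolWeight (z b : R) : ℕ → R
  | 0 => 1
  | n + 1 => (∑ j : Fin (n + 1), (n + 1).choose j • (boolWeight z b j * z ^ (n - j))) * b

/-- The contribution of a Boolean face of rank `j` to the chain polynomial of a poset of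
rank `n`. -/
noncomputable def faceTerm (z b : R) (n j : ℕ) : R :=
  if j < n then boolWeight z b j * z ^ (n - 1 - j) else 0

/-- Raising the rank by one gives each face of rank below `n` one more factor `z`. Faces of rank `n`
start to count, with exponent `0`, and higher ones still vanish. -/
theorem umbral_faceTerm_succ (z b : R) (n : ℕ) (p : ℤ[X]) :
    umbral (faceTerm z b (n + 1)) p
      = umbral (faceTerm z b n) p * z + p.coeff n • boolWeight z b n := by
  induction p using Polynomial.induction_on' with
  | add p q hp hq => simp only [map_add, hp, hq, add_mul, add_smul, coeff_add]; abel
  | monomial j k =>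
    rw [← Polynomial.smul_X_eq_monomial, map_smul, map_smul, umbral_X_pow, umbral_X_pow]
    simp only [coeff_smul, coeff_X_pow, smul_mul_assoc, smul_eq_mul, faceTerm, mul_smul, ← smul_add]
    congr 1
    rcases lt_trichotomy j n with h | rfl | h
    · rw [if_pos (by omega), if_pos h, if_neg (by omega), mul_assoc, ← pow_succ]
      simp only [zero_smul, add_zero]
      congr 2; omega
    · simp
    · rw [if_neg (by omega), if_neg (by omega), if_neg (by omega)]
      simp

/-- The recursion runs over proper subsets only, but the cutoff in `faceTerm` kills the full set, so
the whole binomial `(1 + X) ^ n` may be used. -/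
theorem boolWeight_eq (z b : R) {n : ℕ} (hn : 0 < n) :
    boolWeight z b n = umbral (faceTerm z b n) ((1 + X) ^ n) * b := by
  obtain ⟨n, rfl⟩ := Nat.exists_eq_succ_of_ne_zero hn.ne'
  rw [boolWeight, umbral_one_add_X_pow, Finset.sum_range_succ]
  have : faceTerm z b (n + 1) (n + 1) = 0 := by simp [faceTerm]
  rw [Nat.succ_eq_add_one, this, smul_zero, add_zero, Finset.sum_range]
  congr 1
  refine Finset.sum_congr rfl fun j _ => ?_
  rw [faceTerm, if_pos j.2, Nat.add_sub_cancel]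

theorem coeff_X_pow_mul_one_add_X_pow {n i : ℕ} (hi : i ≤ n) :
    (X ^ i * (1 + X) ^ (n - i) : ℤ[X]).coeff n = 1 := by
  obtain ⟨k, rfl⟩ := Nat.exists_eq_add_of_le hi
  rw [add_comm i k, coeff_X_pow_mul, Nat.add_sub_cancel, coeff_one_add_X_pow]
  simp

/-- The sum of the contributions of the proper faces of an `n`-element set that contain a fixed
`i`-element subset. -/
noncomputable def starSum (z b : R) (n i : ℕ) : R :=
  umbral (faceTerm z b n) (X ^ i * (1 + X) ^ (n - i))

/-- The `ab`-polynomial of `checkPhi n i`. -/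
noncomputable def checkPsi (a b : R) (n i : ℕ) : R :=
  starSum (a - b) b n i * a + (starSum (a - b) b n 0 - starSum (a - b) b n (n - i)) * b

theorem starSum_self (z b : R) (n : ℕ) : starSum z b n n = 0 := by
  simp [starSum, umbral_X_pow, faceTerm]

theorem boolWeight_eq_starSum (z b : R) {n : ℕ} (hn : 0 < n) :
    boolWeight z b n = starSum z b n 0 * b := by
  rw [boolWeight_eq z b hn, starSum]; simp

/-- Among the faces containing a fixed `i`-set, separate those containing one further vertex, which
means splitting one factor `1 + X`. The rest is `X^i (1+X)^(n-i)`, whose coefficient at `X^n` is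
`1`, so lowering the rank releases one Boolean weight. -/
theorem starSum_succ (z b : R) {n i : ℕ} (hn : 0 < n) (hi : i ≤ n) :
    starSum z b (n + 1) i
      = starSum z b (n + 1) (i + 1) + starSum z b n i * z + starSum z b n 0 * b := by
  have h : (X ^ i * (1 + X) ^ (n + 1 - i) : ℤ[X])
      = X ^ (i + 1) * (1 + X) ^ (n + 1 - (i + 1)) + X ^ i * (1 + X) ^ (n - i) := by
    rw [Nat.add_sub_add_right, Nat.sub_add_comm hi]; ring
  rw [starSum, h, map_add, umbral_faceTerm_succ _ _ _ (X ^ i * _), coeff_X_pow_mul_one_add_X_pow hi,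
    one_smul, boolWeight_eq_starSum z b hn, ← add_assoc]
  rfl

theorem checkPsi_self (a b : R) (n : ℕ) : checkPsi a b n n = 0 := by
  simp [checkPsi, starSum_self]

/-- This is the form that arises from posets, while the definition of `checkPsi` is adapted to the
recursion in `n`. -/
theorem checkPsi_eq (a b : R) {n i : ℕ} (hn : 0 < n) (hi : i ≤ n) :
    checkPsi a b n i = umbral (faceTerm (a - b) b (n + 1)) (X ^ i * (1 + X) ^ (n - i))
      + umbral (faceTerm (a - b) b n) (X ^ i * (1 + X) ^ (n - i)) * b
      - umbral (faceTerm (a - b) b n) (X ^ (n - i) * (1 + X) ^ i) * b := by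
  rw [umbral_faceTerm_succ, coeff_X_pow_mul_one_add_X_pow hi, one_smul,
    boolWeight_eq_starSum _ b hn, checkPsi]
  simp only [starSum, Nat.sub_sub_self hi]
  noncomm_ring

/-- The coefficient of `d` in `checkPhi (n + 1) i`. -/
noncomputable def dPart (a b : R) (n i : ℕ) : R :=
  ∑ l ∈ Finset.range i, (starSum (a - b) b n l - starSum (a - b) b n (n - l))

/-- The coefficient of `c` in `checkPhi (n + 1) i`. -/
noncomputable def cPart (a b : R) (n i : ℕ) : R :=
  starSum (a - b) b (n + 1) 0 - ∑ l ∈ Finset.range i, checkPsi a b n l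

/-- Telescoping `starSum_succ`. The next lemma has the same two coefficients with `b` replaced by
`a`; this pairing produces the cd-form in `checkPsi_succ`. -/
theorem starSum_eq_parts (a b : R) {n i : ℕ} (hn : 0 < n) (hi : i ≤ n + 1) :
    starSum (a - b) b (n + 1) i = cPart a b n i + dPart a b n i * b := by
  induction i with
  | zero => simp [cPart, dPart]
  | succ i ih =>
    have h1 := ih (by omega)
    have h2 := starSum_succ (a - b) b hn (show i ≤ n by omega)
    have h3 : starSum (a - b) b (n + 1) (i + 1) = starSum (a - b) b (n + 1) i
        - starSum (a - b) b n i * (a - b) - starSum (a - b) b n 0 * b := by rw [h2]; abel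
    rw [h1] at h3
    rw [h3]
    simp only [cPart, dPart, Finset.sum_range_succ, checkPsi]
    noncomm_ring

theorem starSum_sub_eq_parts (a b : R) {n i : ℕ} (hn : 0 < n) (hi : i ≤ n + 1) :
    starSum (a - b) b (n + 1) 0 - starSum (a - b) b (n + 1) (n + 1 - i)
      = cPart a b n i + dPart a b n i * a := by
  induction i with
  | zero => simp [cPart, dPart, starSum_self]
  | succ i ih =>
    have h1 := ih (by omega)
    -- The recursion is applied at the complementary index `n - i`.
    have h2 := starSum_succ (a - b) b hn (show n - i ≤ n by omega)
    rw [show n - i + 1 = n + 1 - i by omega] at h2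
    have h3 : starSum (a - b) b (n + 1) 0 - starSum (a - b) b (n + 1) (n - i)
        = starSum (a - b) b (n + 1) 0 - starSum (a - b) b (n + 1) (n + 1 - i)
          - starSum (a - b) b n (n - i) * (a - b) - starSum (a - b) b n 0 * b := by
      rw [h2]; abel
    rw [Nat.add_sub_add_right, h3, h1]
    simp only [cPart, dPart, Finset.sum_range_succ, checkPsi]
    noncomm_ring

/-- The summands change sign under `l ↦ n - l`. So the sum over all `l ≤ n` is zero, and
complementary initial segments have equal sums. -/
theorem dPart_reflect (a b : R) {n i : ℕ} (hi : i ≤ n + 1) :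
    dPart a b n (n + 1 - i) = dPart a b n i := by
  induction i with
  | zero =>
    have h := Finset.sum_range_reflect (fun l => starSum (a - b) b n l) (n + 1)
    simp only [Nat.add_sub_cancel] at h
    simp [dPart, Finset.sum_sub_distrib, h]
  | succ i ih =>
    have h := ih (by omega)
    rw [show n + 1 - i = n - i + 1 by omega, dPart, Finset.sum_range_succ, ← dPart,
      Nat.sub_sub_self (by omega : i ≤ n)] at h
    rw [Nat.add_sub_add_right, dPart.eq_def a b n (i + 1), Finset.sum_range_succ, ← dPart, ← h]
    abel

theorem cPart_self (a b : R) {n : ℕ} (hn : 0 < n) : cPart a b n (n + 1) = 0 := by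
  have h := starSum_eq_parts a b hn le_rfl
  have h' := dPart_reflect a b (Nat.zero_le (n + 1))
  rw [starSum_self] at h
  simpa [show dPart a b n (n + 1) = 0 by simpa [dPart] using h'] using h.symm

/-- With `c` and `d` the two parts, this is `(c + d b) a + (c + d a) b = c (a + b) + d (ab + ba)`.
-/
theorem checkPsi_succ (a b : R) {n i : ℕ} (hn : 0 < n) (hi : i ≤ n + 1) :
    checkPsi a b (n + 1) i = cPart a b n i * (a + b) + dPart a b n i * (a * b + b * a) := by
  rw [checkPsi, starSum_sub_eq_parts a b hn hi, starSum_eq_parts a b hn hi]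
  noncomm_ring

/-- The two claims need a joint induction: `cPart` is built from `checkPsi` of lower rank, and
`dPart` from the differences of star sums. -/
theorem checkPsi_mem {A : Subring R} {a b : R} (hc : a + b ∈ A) (hd : a * b + b * a ∈ A)
    {n : ℕ} (hn : 0 < n) :
    (∀ i ≤ n, starSum (a - b) b n i - starSum (a - b) b n (n - i) ∈ A) ∧
      ∀ i ≤ n, checkPsi a b n i ∈ A := by
  induction n, hn using Nat.le_induction with
  | base =>
    have h0 : starSum (a - b) b 1 0 = 1 := by
      rw [starSum, pow_zero, one_mul, umbral_one_add_X_pow]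
      simp [faceTerm, boolWeight]
    have h1 := starSum_self (a - b) b 1
    constructor
    · intro i hi
      interval_cases i <;> simp [h0, h1, A.one_mem, A.neg_mem]
    · intro i hi
      interval_cases i <;> simp [checkPsi, h0, h1, hc]
  | succ n hn ih =>
    have hC : ∀ i ≤ n + 1, cPart a b n i ∈ A := by
      intro i hi
      -- By `cPart_self` the initial value is the full sum of the `checkPsi a b n l`, so subtracting
      -- a head leaves a tail.
      have h : cPart a b n i = ∑ l ∈ Finset.Ico i (n + 1), checkPsi a b n l := by
        rw [Finset.sum_Ico_eq_sub _ hi, ← sub_eq_zero.1 (cPart_self a b hn)]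
        rfl
      rw [h]
      exact A.sum_mem fun l hl => ih.2 l (by simp at hl; omega)
    have hD : ∀ i ≤ n + 1, dPart a b n i ∈ A := fun i hi =>
      A.sum_mem fun l hl => ih.1 l (by simp at hl; omega)
    constructor
    · intro i hi
      rw [starSum_eq_parts a b hn hi, starSum_eq_parts a b hn (Nat.sub_le _ _), dPart_reflect a b hi,
        add_sub_add_right_eq_sub]
      exact A.sub_mem (hC i hi) (hC _ (Nat.sub_le _ _))
    · intro i hi
      rw [checkPsi_succ a b hn hi]
      exact A.add_mem (A.mul_mem (hC i hi) hc) (A.mul_mem (hD i hi) hd)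

end Algebra

/-! ### Right derivatives on free algebras -/

section RightDerivative

variable {X : Type*}

/-- The algebra homomorphism `p ↦ (p, D p; 0, ε p)`, where `ε` is the augmentation and `D` the
right derivative with `D (p * x) = δ x • p`. -/
noncomputable def derivHom (δ : X → ℤ) :
    FreeAlgebra ℤ X →ₐ[ℤ] Matrix (Fin 2) (Fin 2) (FreeAlgebra ℤ X) :=
  FreeAlgebra.lift ℤ fun x => !![FreeAlgebra.ι ℤ x, algebraMap ℤ _ (δ x); 0, 0]

/-- The right derivative with `D (p * x) = δ x • p`. -/
noncomputable def rightDeriv (δ : X → ℤ) (p : FreeAlgebra ℤ X) : FreeAlgebra ℤ X :=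
  derivHom δ p 0 1

theorem derivHom_zero_zero (δ : X → ℤ) (p : FreeAlgebra ℤ X) : derivHom δ p 0 0 = p ∧
    derivHom δ p 1 0 = 0 := by
  induction p using FreeAlgebra.induction with
  | grade0 r => rw [AlgHom.commutes]; simp [Matrix.algebraMap_matrix_apply, -eq_intCast]
  | grade1 x => simp [derivHom]
  | mul p q hp hq => simp [Matrix.mul_apply, hp, hq]
  | add p q hp hq => simp [hp, hq]

theorem rightDeriv_add (δ : X → ℤ) (p q : FreeAlgebra ℤ X) :
    rightDeriv δ (p + q) = rightDeriv δ p + rightDeriv δ q := by simp [rightDeriv]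

theorem rightDeriv_sub (δ : X → ℤ) (p q : FreeAlgebra ℤ X) :
    rightDeriv δ (p - q) = rightDeriv δ p - rightDeriv δ q := by simp [rightDeriv]

theorem rightDeriv_algebraMap (δ : X → ℤ) (k : ℤ) :
    rightDeriv δ (algebraMap ℤ _ k) = 0 := by
  rw [rightDeriv, AlgHom.commutes]; simp [Matrix.algebraMap_matrix_apply]

theorem rightDeriv_zero (δ : X → ℤ) : rightDeriv δ 0 = 0 := by simp [rightDeriv]

theorem rightDeriv_mul_ι (δ : X → ℤ) (p : FreeAlgebra ℤ X) (x : X) :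
    rightDeriv δ (p * FreeAlgebra.ι ℤ x) = p * algebraMap ℤ _ (δ x) := by
  rw [rightDeriv, map_mul, Matrix.mul_apply, Fin.sum_univ_two, (derivHom_zero_zero δ p).1]
  simp [derivHom]

end RightDerivative

/-! ### Uniqueness of the cd-index -/

section CDInjectivity

open FreeAlgebra

/-- The right derivatives with respect to `a` and `b`. -/
noncomputable def derivAB (x : ABVar) : ABPoly → ABPoly :=
  open Classical in rightDeriv fun y => if y = x then 1 else 0

/-- The right derivatives with respect to `c` and `d`. -/
noncomputable def derivCD (x : CDVar) : CDPoly → CDPoly :=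
  open Classical in rightDeriv fun y => if y = x then 1 else 0

theorem exists_cd_decomposition (w : CDPoly) :
    ∃ (k : ℤ) (p q : CDPoly), w = algebraMap ℤ _ k + p * ι ℤ CDVar.c + q * ι ℤ CDVar.d := by
  induction w using FreeAlgebra.induction with
  | grade0 r => exact ⟨r, 0, 0, by simp⟩
  | grade1 x =>
    cases x
    · exact ⟨0, 1, 0, by simp⟩
    · exact ⟨0, 0, 1, by simp⟩
  | mul v w hv hw =>
    obtain ⟨k, p, q, hv⟩ := hv
    obtain ⟨l, r, s, hw⟩ := hw
    refine ⟨k * l, algebraMap ℤ _ l * p + v * r, algebraMap ℤ _ l * q + v * s, ?_⟩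
    rw [hw, mul_add, mul_add, ← Algebra.commutes, add_mul, add_mul, map_mul,
      ← mul_assoc, ← mul_assoc]
    have h : algebraMap ℤ CDPoly l * v = algebraMap ℤ _ k * algebraMap ℤ _ l
        + algebraMap ℤ _ l * p * ι ℤ CDVar.c + algebraMap ℤ _ l * q * ι ℤ CDVar.d := by
      nth_rw 1 [hv]
      rw [mul_add, mul_add, ← map_mul, ← map_mul, mul_comm l k,
        mul_assoc, mul_assoc]
    rw [h]
    abel
  | add v w hv hw =>
    obtain ⟨k, p, q, rfl⟩ := hv
    obtain ⟨l, r, s, rfl⟩ := hw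
    exact ⟨k + l, p + r, q + s, by rw [map_add, add_mul, add_mul]; abel⟩

theorem derivCD_decomposition (k : ℤ) (p q : CDPoly) :
    derivCD CDVar.c (algebraMap ℤ _ k + p * ι ℤ CDVar.c + q * ι ℤ CDVar.d) = p ∧
      derivCD CDVar.d (algebraMap ℤ _ k + p * ι ℤ CDVar.c + q * ι ℤ CDVar.d) = q := by
  simp [derivCD, rightDeriv_add, rightDeriv_mul_ι, rightDeriv_algebraMap, -eq_intCast]

/-- The polynomials all of whose right derivatives of order `N` vanish. -/
def cdFiltration : ℕ → Set CDPoly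
  | 0 => {0}
  | N + 1 => {w | ∀ x, derivCD x w ∈ cdFiltration N}

theorem zero_mem_cdFiltration (N : ℕ) : (0 : CDPoly) ∈ cdFiltration N := by
  induction N with
  | zero => rfl
  | succ N ih => intro x; rwa [derivCD, rightDeriv_zero]

theorem cdFiltration_mono {N : ℕ} : cdFiltration N ⊆ cdFiltration (N + 1) := by
  induction N with
  | zero => rintro _ rfl; exact zero_mem_cdFiltration _
  | succ N ih => exact fun w hw x => ih (hw x)

theorem cdFiltration_add {N : ℕ} {v w : CDPoly} (hv : v ∈ cdFiltration N)
    (hw : w ∈ cdFiltration N) : v + w ∈ cdFiltration N := by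
  induction N generalizing v w with
  | zero =>
    rw [Set.mem_singleton_iff.1 hv, Set.mem_singleton_iff.1 hw, add_zero]; rfl
  | succ N ih => intro x; rw [derivCD, rightDeriv_add]; exact ih (hv x) (hw x)

/-- Quantifying over the left factor `v` lets the induction on `w` absorb a product one factor at a
time, by associativity. -/
theorem exists_mul_mem_cdFiltration (w : CDPoly) :
    ∀ v, (∃ N, v ∈ cdFiltration N) → ∃ N, v * w ∈ cdFiltration N := by
  induction w using FreeAlgebra.induction with
  | grade0 r =>
    rintro v ⟨N, hv⟩
    refine ⟨N, ?_⟩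
    induction N generalizing v with
    | zero => rw [Set.mem_singleton_iff.1 hv, zero_mul]; rfl
    | succ N ih =>
      intro x
      have : derivCD x (v * algebraMap ℤ _ r) = derivCD x v * algebraMap ℤ _ r := by
        rw [← Algebra.commutes, ← Algebra.commutes, ← Algebra.smul_def, ← Algebra.smul_def]
        rw [derivCD, rightDeriv, map_smul]; rfl
      rw [this]
      exact ih _ (hv x)
  | grade1 y =>
    rintro v ⟨N, hv⟩
    refine ⟨N + 1, fun x => ?_⟩
    rw [derivCD, rightDeriv_mul_ι]
    split_ifs
    · simpa using hv
    · simpa using zero_mem_cdFiltration N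
  | mul p q hp hq =>
    intro v hv
    rw [← mul_assoc]
    exact hq _ (hp _ hv)
  | add p q hp hq =>
    intro v hv
    obtain ⟨N, hN⟩ := hp v hv
    obtain ⟨K, hK⟩ := hq v hv
    have hm : Monotone cdFiltration := monotone_nat_of_le_succ fun _ => cdFiltration_mono
    exact ⟨max N K, by
      rw [mul_add]
      exact cdFiltration_add (hm (le_max_left _ _) hN) (hm (le_max_right _ _) hK)⟩

theorem exists_mem_cdFiltration (w : CDPoly) : ∃ N, w ∈ cdFiltration N := by
  have h := exists_mul_mem_cdFiltration w 1 ⟨1, fun x => ?_⟩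
  · rwa [one_mul] at h
  · rw [← map_one (algebraMap ℤ CDPoly), derivCD, rightDeriv_algebraMap]; rfl

/-- Write `w = k + p c + q d` and let `P`, `Q` be the images of `p`, `q`. The image of `w` is `k +
(P + Q b) a + (P + Q a) b`. If it vanishes, its right derivatives give `P + Q b = P + Q a = 0`, so
`Q (a - b) = 0`, whence `Q = 0` and `P = 0`. The filtration serves as the degree, since `p` and `q`
are right derivatives of `w`. -/
theorem substCD_injective : Function.Injective substCD := by
  rw [injective_iff_map_eq_zero]
  intro w hw
  obtain ⟨N, hN⟩ := exists_mem_cdFiltration w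
  induction N generalizing w with
  | zero => exact hN
  | succ N ih =>
    obtain ⟨k, p, q, rfl⟩ := exists_cd_decomposition w
    have hp := hN CDVar.c
    have hq := hN CDVar.d
    rw [(derivCD_decomposition k p q).1] at hp
    rw [(derivCD_decomposition k p q).2] at hq
    have hs : algebraMap ℤ _ k + substCD p * ι ℤ ABVar.a + substCD p * ι ℤ ABVar.b
        + substCD q * ι ℤ ABVar.a * ι ℤ ABVar.b + substCD q * ι ℤ ABVar.b * ι ℤ ABVar.a = 0 := by
      rw [← hw]
      simp only [map_add, map_mul, AlgHom.commutes, substCD, lift_ι_apply, polyA, polyB]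
      noncomm_ring
    have ha := congrArg (derivAB ABVar.a) hs
    have hb := congrArg (derivAB ABVar.b) hs
    simp only [derivAB, rightDeriv_add, rightDeriv_mul_ι, rightDeriv_algebraMap, rightDeriv_zero]
      at ha hb
    simp at ha hb
    have hab : substCD q * ι ℤ ABVar.a - substCD q * ι ℤ ABVar.b = 0 := by
      rw [← sub_self (0 : ABPoly)]
      nth_rw 1 [← hb]
      rw [← ha]
      abel
    have hq' := congrArg (derivAB ABVar.a) hab
    simp only [derivAB, rightDeriv_sub, rightDeriv_mul_ι, rightDeriv_zero] at hq'
    simp at hq'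
    rw [hq', zero_mul, add_zero] at ha
    rw [ih _ hq' hq, ih _ ha hp] at hw ⊢
    simp only [zero_mul, add_zero, AlgHom.commutes] at hw ⊢
    -- Only the constant `k` is left; the augmentation recovers it.
    have := congrArg (algebraMapInv (R := ℤ) (X := ABVar)) hw
    rw [algebraMap_leftInverse, map_zero] at this
    rw [this, map_zero]

end CDInjectivity

/-! ### Counting chains below an element -/

section FlagNumbers

variable {P : Type*} [PartialOrder P] [GradeMinOrder ℕ P]

/-- The number of chains with rank set `S` all of whose elements are below `x`. -/
noncomputable def flagBelow (x : P) (S : Finset ℕ) : ℕ :=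
  Nat.card {f : S → P // (StrictMono f ∧ ∀ l : S, grade ℕ (f l) = (l : ℕ)) ∧ ∀ l, f l < x}

theorem flagBelow_empty (x : P) : flagBelow x ∅ = 1 := by
  rw [flagBelow, Nat.card_eq_one_iff_unique]
  refine ⟨⟨fun f g => Subtype.ext (funext fun l => (Finset.notMem_empty _ l.2).elim)⟩,
    ⟨⟨fun l => (Finset.notMem_empty _ l.2).elim, ⟨fun l => (Finset.notMem_empty _ l.2).elim,
      fun l => (Finset.notMem_empty _ l.2).elim⟩, fun l => (Finset.notMem_empty _ l.2).elim⟩⟩⟩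

/-- A chain with greatest rank `k` is an element of rank `k` with a chain below it. -/
noncomputable def flagBelowInsertEquiv (x : P) {S : Finset ℕ} {k : ℕ} (hk : ∀ l ∈ S, l < k) :
    {f : ↥(insert k S) → P //
      (StrictMono f ∧ ∀ l : ↥(insert k S), grade ℕ (f l) = (l : ℕ)) ∧ ∀ l, f l < x} ≃
    Σ y : {y : P // y < x ∧ grade ℕ y = k},
      {f : S → P // (StrictMono f ∧ ∀ l : S, grade ℕ (f l) = (l : ℕ)) ∧ ∀ l, f l < (y : P)} where
  toFun f := ⟨⟨f.1 ⟨k, Finset.mem_insert_self k S⟩, f.2.2 _, f.2.1.2 _⟩,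
    ⟨fun l => f.1 ⟨l, Finset.mem_insert_of_mem l.2⟩,
      ⟨fun l m h => f.2.1.1 h, fun l => f.2.1.2 _⟩, fun l => f.2.1.1 (hk l l.2)⟩⟩
  invFun g := ⟨fun l => if h : (l : ℕ) ∈ S then g.2.1 ⟨l, h⟩ else g.1, by
    have hmem : ∀ l : ↥(insert k S), (l : ℕ) ∉ S → (l : ℕ) = k := fun l hl =>
      (Finset.mem_insert.1 l.2).resolve_right hl
    refine ⟨⟨fun l m h => ?_, fun l => ?_⟩, fun l => ?_⟩
    · by_cases hm : (m : ℕ) ∈ S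
      · by_cases hl : (l : ℕ) ∈ S
        · simp only [hl, hm, dite_true]
          exact g.2.2.1.1 h
        · have h1 := hk m hm
          have h2 : (l : ℕ) < m := h
          have := hmem l hl
          omega
      · have h1 := hmem m hm
        have hl : (l : ℕ) ∈ S := by
          by_contra hl
          have h2 : (l : ℕ) < m := h
          have := hmem l hl
          omega
        simp only [hl, hm, dite_true, dite_false]
        exact g.2.2.2 _
    · by_cases hl : (l : ℕ) ∈ S
      · simp only [hl, dite_true]; exact g.2.2.1.2 _
      · exact (congrArg (grade ℕ) (dif_neg hl)).trans (g.1.2.2.trans (hmem l hl).symm)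
    · by_cases hl : (l : ℕ) ∈ S
      · simp only [hl, dite_true]; exact (g.2.2.2 _).trans g.1.2.1
      · simp only [hl, dite_false, g.1.2.1]⟩
  left_inv f := by
    refine Subtype.ext (funext fun l => ?_)
    by_cases hl : (l : ℕ) ∈ S
    · simp [hl]
    · have h : (l : ℕ) = k := (Finset.mem_insert.1 l.2).resolve_right hl
      have : l = ⟨k, Finset.mem_insert_self k S⟩ := Subtype.ext h
      exact (dif_neg hl).trans (congrArg f.1 this.symm)
  right_inv g := by
    have hkS : k ∉ S := fun h => lt_irrefl _ (hk k h)
    -- The type of the second component depends on the first, so equality of pairs is reduced to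
    -- equality of elements of `P`.
    have key : ∀ A B : Σ y : {y : P // y < x ∧ grade ℕ y = k}, {f : S → P //
        (StrictMono f ∧ ∀ l : S, grade ℕ (f l) = (l : ℕ)) ∧ ∀ l, f l < (y : P)},
        (A.1 : P) = B.1 → (∀ l, A.2.1 l = B.2.1 l) → A = B := by
      rintro ⟨⟨y, hy⟩, ⟨f, hf⟩⟩ ⟨⟨y', hy'⟩, ⟨f', hf'⟩⟩ h1 h2
      dsimp only at h1 h2
      subst h1
      obtain rfl : f = f' := funext h2
      rfl
    exact key _ _ (dif_neg hkS) fun l => dif_pos l.2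

open Classical in
theorem flagBelow_insert [Fintype P] (x : P) {S : Finset ℕ} {k : ℕ} (hk : ∀ l ∈ S, l < k) :
    flagBelow x (insert k S) = ∑ y : P with y < x ∧ grade ℕ y = k, flagBelow y S := by
  rw [flagBelow, Nat.card_congr (flagBelowInsertEquiv x hk), Nat.card_sigma,
    ← Finset.sum_subtype_eq_sum_filter, Finset.subtype_univ]
  rfl

theorem flagF_eq_flagBelow [OrderTop P] {n : ℕ} (hrank : grade ℕ (⊤ : P) = n + 1)
    {S : Finset ℕ} (hS : S ⊆ Finset.Icc 1 n) : flagF P S = flagBelow (⊤ : P) S := by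
  refine Nat.card_congr (Equiv.subtypeEquivRight fun f => (and_iff_left_of_imp ?_).symm)
  rintro ⟨-, hf⟩ l
  refine lt_top_iff_ne_top.2 fun h => ?_
  have h1 := hf l
  have h2 := (Finset.mem_Icc.1 (hS l.2)).2
  rw [h, hrank] at h1
  omega

end FlagNumbers

/-! ### Chain polynomials grouped by the greatest chain element -/

section ChainPolynomial

theorem substAB_monomialU_succ (n : ℕ) (S : Finset ℕ) :
    substAB (monomialU (n + 1) S)
      = substAB (monomialU n S) * if n + 1 ∈ S then polyB else polyA - polyB := by
  rw [monomialU, List.range_succ, List.map_append, List.prod_append, map_mul, ← monomialU]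
  congr 1
  rw [List.map_singleton, List.prod_singleton]
  split_ifs <;> simp [substAB, polyA, polyB]

theorem monomialU_insert (n : ℕ) (S : Finset ℕ) :
    monomialU n (insert (n + 1) S) = monomialU n S := by
  rw [monomialU, monomialU]
  congr 1
  refine List.map_congr_left fun i hi => ?_
  have : i ≠ n := (List.mem_range.1 hi).ne
  simp [this]

theorem substAB_monomialU_empty (n : ℕ) :
    substAB (monomialU n ∅) = (polyA - polyB) ^ n := by
  induction n with
  | zero => simp [monomialU]
  | succ n ih => rw [substAB_monomialU_succ, ih, pow_succ]; simp

theorem substAB_monomialU_singleton (n : ℕ) :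
    substAB (monomialU (n + 1) {n + 1}) = (polyA - polyB) ^ n * polyB := by
  rw [substAB_monomialU_succ, ← insert_empty_eq, monomialU_insert, substAB_monomialU_empty]
  simp

variable {P : Type*} [PartialOrder P] [GradeMinOrder ℕ P]

/-- The part of the chain polynomial which comes from the chains below `x` with ranks in
`{1, …, m}`. -/
noncomputable def chainSum (m : ℕ) (x : P) : ABPoly :=
  ∑ S ∈ (Finset.Icc 1 m).powerset, flagBelow x S • substAB (monomialU m S)

/-- The part of the chain polynomial which comes from the chains with greatest element `x`. -/
noncomputable def chainWeight (x : P) : ABPoly :=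
  if grade ℕ x = 0 then 1 else chainSum (grade ℕ x - 1) x * polyB

variable [Fintype P]

-- Split the rank sets by whether they contain `m + 1`. If not, the last letter is `a - b`; if so,
-- it is `b`, and the greatest chain element `y` has rank `m + 1`.
open Classical in
theorem chainSum_succ (m : ℕ) (x : P) :
    chainSum (m + 1) x = chainSum m x * (polyA - polyB)
      + ∑ y : P with y < x ∧ grade ℕ y = m + 1, chainSum m y * polyB := by
  have hnot : ∀ S ∈ (Finset.Icc 1 m).powerset, m + 1 ∉ S := fun S hS h => by
    have := Finset.mem_Icc.1 (Finset.mem_powerset.1 hS h); omega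
  rw [chainSum, ← Finset.insert_Icc_right_eq_Icc_add_one (by omega), Finset.sum_powerset_insert]
  · congr 1
    · rw [chainSum, Finset.sum_mul]
      refine Finset.sum_congr rfl fun S hS => ?_
      rw [substAB_monomialU_succ, if_neg (hnot S hS), smul_mul_assoc]
    · simp only [chainSum, Finset.sum_mul]
      rw [Finset.sum_comm]
      refine Finset.sum_congr rfl fun S hS => ?_
      rw [substAB_monomialU_succ, if_pos (Finset.mem_insert_self _ _), monomialU_insert,
        flagBelow_insert, Finset.sum_smul]
      · simp only [smul_mul_assoc]
      · intro l hl
        have := Finset.mem_Icc.1 (Finset.mem_powerset.1 hS hl); omega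
  · simp

variable [OrderBot P]

-- For a chain with greatest element `y`, the letters up to the rank of `y` enter `chainWeight y`
-- and all later ones are `a - b`. The empty chain is represented by `y = ⊥` with weight `1`, hence
-- the need for `⊥ < x`.
open Classical in
theorem chainSum_eq_sum (m : ℕ) {x : P} (hx : ⊥ < x) :
    chainSum m x = ∑ y : P with y < x ∧ grade ℕ y ≤ m,
      chainWeight y * (polyA - polyB) ^ (m - grade ℕ y) := by
  induction m with
  | zero =>
    have h : (Finset.univ.filter fun y : P => y < x ∧ grade ℕ y ≤ 0) = {⊥} := by
      ext y
      simp only [Finset.mem_filter, Finset.mem_univ, true_and, Finset.mem_singleton]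
      constructor
      · rintro ⟨-, hy⟩
        by_contra hne
        have := grade_strictMono (𝕆 := ℕ) (bot_lt_iff_ne_bot.2 hne)
        omega
      · rintro rfl
        exact ⟨hx, by simp⟩
    rw [h, Finset.sum_singleton, chainSum]
    simp [flagBelow_empty, monomialU, chainWeight]
  | succ m ih =>
    have h : (Finset.univ.filter fun y : P => y < x ∧ grade ℕ y ≤ m + 1)
        = (Finset.univ.filter fun y : P => y < x ∧ grade ℕ y ≤ m) ∪
          (Finset.univ.filter fun y : P => y < x ∧ grade ℕ y = m + 1) := by
      ext y
      simp only [Finset.mem_filter, Finset.mem_univ, true_and, Finset.mem_union, Nat.le_succ_iff,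
        and_or_left]
    rw [h, Finset.sum_union, chainSum_succ, ih, Finset.sum_mul]
    · congr 1
      · refine Finset.sum_congr rfl fun y hy => ?_
        have hy := (Finset.mem_filter.1 hy).2.2
        rw [mul_assoc, ← pow_succ, Nat.sub_add_comm hy]
      · refine Finset.sum_congr rfl fun y hy => ?_
        have hy := (Finset.mem_filter.1 hy).2.2
        rw [chainWeight, hy]
        simp
    · rw [Finset.disjoint_filter]
      rintro y - ⟨-, h1⟩ ⟨-, h2⟩
      omega

open Classical in
theorem chainSum_pred_grade {x : P} (hx : ⊥ < x) :
    chainSum (grade ℕ x - 1) x = ∑ y : P with y < x,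
      chainWeight y * (polyA - polyB) ^ (grade ℕ x - 1 - grade ℕ y) := by
  rw [chainSum_eq_sum _ hx]
  refine Finset.sum_congr (Finset.filter_congr fun y _ => and_iff_left_of_imp fun h => ?_)
    fun _ _ => rfl
  have := grade_strictMono (𝕆 := ℕ) h
  omega

end ChainPolynomial

/-! ### The Euler characteristic correction -/

section ModifiedChainPolynomial

open Polynomial

variable (P : Type*) [PartialOrder P] [BoundedOrder P] [GradeMinOrder ℕ P] [Fintype P]

open Classical in
/-- The rank generating function of the proper part of `P` together with the least element. -/
noncomputable def rankPoly : ℤ[X] := ∑ x : P with x < ⊤, X ^ grade ℕ x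

variable {P}

open Classical in
theorem flagF_singleton {n : ℕ} (hrank : grade ℕ (⊤ : P) = n + 1) {j : ℕ}
    (hj : j ∈ Finset.Icc 1 n) :
    flagF P {j} = (Finset.univ.filter fun x : P => x < ⊤ ∧ grade ℕ x = j).card := by
  rw [flagF_eq_flagBelow hrank (Finset.singleton_subset_iff.2 hj), ← insert_empty_eq,
    flagBelow_insert _ (by simp)]
  simp [flagBelow_empty]

open Classical in
theorem sum_lt_top_eq {n : ℕ} (hrank : grade ℕ (⊤ : P) = n + 1) (g : ℕ → ℤ) :
    ∑ x : P with x < ⊤, g (grade ℕ x) = g 0 + ∑ j ∈ Finset.Icc 1 n, (flagF P {j} : ℤ) * g j := by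
  have hmaps : ∀ x ∈ (Finset.univ.filter fun x : P => x < ⊤), grade ℕ x ∈ Finset.Icc 0 n := by
    intro x hx
    have := grade_strictMono (𝕆 := ℕ) (Finset.mem_filter.1 hx).2
    simp only [Finset.mem_Icc]
    omega
  have hIcc : Finset.Icc 0 n = insert 0 (Finset.Icc 1 n) := by
    ext j; simp only [Finset.mem_Icc, Finset.mem_insert]; omega
  rw [← Finset.sum_fiberwise_of_maps_to hmaps, hIcc, Finset.sum_insert (by simp)]
  congr 1
  · have h : ((Finset.univ.filter fun x : P => x < ⊤).filter fun x => grade ℕ x = 0) = {⊥} := by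
      ext y
      simp only [Finset.mem_filter, Finset.mem_univ, true_and, Finset.mem_singleton]
      constructor
      · rintro ⟨-, hy⟩
        by_contra hne
        have := grade_strictMono (𝕆 := ℕ) (bot_lt_iff_ne_bot.2 hne)
        omega
      · rintro rfl
        refine ⟨bot_lt_iff_ne_bot.2 fun h => ?_, by simp⟩
        rw [h, grade_bot] at hrank
        exact absurd hrank (by simp)
    rw [h, Finset.sum_singleton, grade_bot]
    rfl
  · refine Finset.sum_congr rfl fun j hj => ?_
    rw [flagF_singleton hrank hj, Finset.filter_filter, ← nsmul_eq_mul, ← Finset.sum_const]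
    exact Finset.sum_congr rfl fun x hx => by rw [(Finset.mem_filter.1 hx).2.2]

theorem one_sub_eulerChar {n : ℕ} (hrank : grade ℕ (⊤ : P) = n + 1) :
    1 - eulerChar n P = (rankPoly P).eval (-1) := by
  classical
  rw [rankPoly, eval_finsetSum]
  simp only [eval_pow, eval_X]
  rw [sum_lt_top_eq hrank fun j => (-1) ^ j, eulerChar, pow_zero, sub_eq_add_neg,
    ← Finset.sum_neg_distrib]
  congr 1
  refine Finset.sum_congr rfl fun j hj => ?_
  obtain ⟨k, rfl⟩ := Nat.exists_eq_add_of_le' (Finset.mem_Icc.1 hj).1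
  rw [Nat.add_sub_cancel, pow_succ]
  ring

-- The correction `χ(𝕊^(n-1)) - χ(P)` equals `F(-1) - (-1)^n` for `F = rankPoly P`, by
-- `one_sub_eulerChar`. It belongs to the rank set `{n}`, whose monomial becomes `(a - b)^(n-1) b`.
open Classical in
theorem substAB_modifiedChainPoly {n : ℕ} (hn : 1 ≤ n) (hrank : grade ℕ (⊤ : P) = n + 1) :
    substAB (modifiedChainPoly n P) = ∑ x : P with x < ⊤,
        chainWeight x * (polyA - polyB) ^ (n - grade ℕ x)
      + ((rankPoly P).eval (-1) - (-1) ^ n) • ((polyA - polyB) ^ (n - 1) * polyB) := by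
  have htop : (⊥ : P) < ⊤ := by
    refine bot_lt_iff_ne_bot.2 fun h => ?_
    rw [h, grade_bot] at hrank
    exact absurd hrank (by simp)
  have h1 : ∀ S ∈ (Finset.Icc 1 n).powerset, modifiedFlagF n P S • substAB (monomialU n S)
      = flagBelow (⊤ : P) S • substAB (monomialU n S)
        + if S = {n} then ((rankPoly P).eval (-1) - (-1) ^ n) • substAB (monomialU n {n})
          else 0 := by
    intro S hS
    have hS' := flagF_eq_flagBelow hrank (Finset.mem_powerset.1 hS)
    rw [modifiedFlagF, ← one_sub_eulerChar hrank, ← hS']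
    split_ifs with h
    · subst h
      rw [← natCast_zsmul, ← add_smul]
      congr 1
      ring
    · rw [add_zero, natCast_zsmul]
  rw [modifiedChainPoly, map_sum]
  simp only [map_zsmul]
  rw [Finset.sum_congr rfl h1, Finset.sum_add_distrib, Finset.sum_ite_eq', if_pos (by simpa)]
  have h2 := chainSum_pred_grade htop
  rw [hrank, Nat.add_sub_cancel] at h2
  rw [← h2, chainSum]
  obtain ⟨m, rfl⟩ := Nat.exists_eq_add_of_le' hn
  rw [substAB_monomialU_singleton, Nat.add_sub_cancel]

end ModifiedChainPolynomial

/-! ### Boolean lower intervals -/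

section BooleanChart

variable {P V : Type*} [PartialOrder P]

/-- The map `φ` identifies the Boolean algebra of the subsets of `F` with the elements of `P`
below `φ F`. -/
structure IsBooleanChart (φ : Finset V → P) (F : Finset V) : Prop where
  le_iff : ∀ G ⊆ F, ∀ H ⊆ F, φ G ≤ φ H ↔ G ⊆ H
  exists_eq : ∀ y ≤ φ F, ∃ G ⊆ F, φ G = y

namespace IsBooleanChart

variable {φ : Finset V → P} {F : Finset V}

theorem mono (h : IsBooleanChart φ F) {G : Finset V} (hG : G ⊆ F) : IsBooleanChart φ G where
  le_iff H hH K hK := h.le_iff H (hH.trans hG) K (hK.trans hG)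
  exists_eq y hy := by
    obtain ⟨H, hH, rfl⟩ := h.exists_eq y (hy.trans ((h.le_iff G hG F subset_rfl).2 hG))
    exact ⟨H, (h.le_iff H hH G hG).1 hy, rfl⟩

theorem injOn (h : IsBooleanChart φ F) {G H : Finset V} (hG : G ⊆ F) (hH : H ⊆ F)
    (hGH : φ G = φ H) : G = H :=
  ((h.le_iff G hG H hH).1 hGH.le).antisymm ((h.le_iff H hH G hG).1 hGH.ge)

theorem lt_iff (h : IsBooleanChart φ F) {G H : Finset V} (hG : G ⊆ F) (hH : H ⊆ F) :
    φ G < φ H ↔ G ⊂ H := by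
  rw [lt_iff_le_not_ge, h.le_iff G hG H hH, h.le_iff H hH G hG]; rfl

theorem map_empty [OrderBot P] (h : IsBooleanChart φ F) : φ ∅ = ⊥ := by
  obtain ⟨G, hG, hG'⟩ := h.exists_eq ⊥ bot_le
  rw [← le_bot_iff, ← hG']
  exact (h.le_iff _ (Finset.empty_subset _) _ hG).2 (Finset.empty_subset _)

theorem grade_eq [OrderBot P] [GradeMinOrder ℕ P] (h : IsBooleanChart φ F) :
    grade ℕ (φ F) = F.card := by
  classical
  induction F using Finset.induction_on with
  | empty => rw [h.map_empty, grade_bot]; rfl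
  | insert a F ha ih =>
    have hF := Finset.subset_insert a F
    have hcov : φ F ⋖ φ (insert a F) := by
      refine ⟨(h.lt_iff hF subset_rfl).2 (Finset.ssubset_insert ha), fun y hy1 hy2 => ?_⟩
      obtain ⟨G, hG, rfl⟩ := h.exists_eq y hy2.le
      exact (Finset.covBy_insert ha).2 ((h.lt_iff hF hG).1 hy1) ((h.lt_iff hG subset_rfl).1 hy2)
    rw [← Nat.covBy_iff_add_one_eq.1 (hcov.grade ℕ), ih (h.mono hF), Finset.card_insert_of_notMem ha]

variable [Fintype P]

open Classical in
theorem sum_le {M : Type*} [AddCommMonoid M] (h : IsBooleanChart φ F) (g : P → M) :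
    ∑ y : P with y ≤ φ F, g y = ∑ G ∈ F.powerset, g (φ G) := by
  refine (Finset.sum_nbij φ ?_ ?_ ?_ fun _ _ => rfl).symm
  · intro G hG
    have hG := Finset.mem_powerset.1 hG
    simpa using (h.le_iff G hG F subset_rfl).2 hG
  · intro G hG H hH hGH
    exact h.injOn (Finset.mem_powerset.1 hG) (Finset.mem_powerset.1 hH) hGH
  · intro y hy
    obtain ⟨G, hG, rfl⟩ := h.exists_eq y (by simpa using hy)
    exact ⟨G, by simpa using hG, rfl⟩

open Classical in
theorem sum_lt {M : Type*} [AddCommMonoid M] (h : IsBooleanChart φ F) (g : P → M) :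
    ∑ y : P with y < φ F, g y = ∑ G ∈ F.ssubsets, g (φ G) := by
  refine (Finset.sum_nbij φ ?_ ?_ ?_ fun _ _ => rfl).symm
  · intro G hG
    have hG := Finset.mem_ssubsets.1 hG
    simpa using (h.lt_iff hG.subset subset_rfl).2 hG
  · intro G hG H hH hGH
    exact h.injOn (Finset.mem_ssubsets.1 hG).subset (Finset.mem_ssubsets.1 hH).subset hGH
  · intro y hy
    have hy : y < φ F := by simpa using hy
    obtain ⟨G, hG, rfl⟩ := h.exists_eq y hy.le
    exact ⟨G, by simpa using (h.lt_iff hG subset_rfl).1 hy, rfl⟩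

variable [OrderBot P] [GradeMinOrder ℕ P]

-- By strong induction the proper subsets of `F` reproduce the recursion of `boolWeight`. Passing
-- from `ssubsets` to the whole power set is harmless because the term of `F` itself is zero.
open Polynomial in
theorem chainWeight_eq (h : IsBooleanChart φ F) :
    chainWeight (φ F) = boolWeight (polyA - polyB) polyB F.card := by
  classical
  induction F using Finset.strongInduction with
  | H F ih =>
    rcases F.eq_empty_or_nonempty with rfl | hF
    · rw [chainWeight, h.grade_eq, if_pos Finset.card_empty, Finset.card_empty, boolWeight]
    · have hpos := hF.card_pos
      have hbot : ⊥ < φ F := by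
        rw [← h.map_empty, h.lt_iff (Finset.empty_subset _) subset_rfl]
        exact Finset.empty_ssubset.2 hF
      have hterm : ∀ G ∈ F.ssubsets, chainWeight (φ G) *
          (polyA - polyB) ^ (grade ℕ (φ F) - 1 - grade ℕ (φ G))
            = faceTerm (polyA - polyB) polyB F.card G.card := by
        intro G hG
        have hG := Finset.mem_ssubsets.1 hG
        rw [ih G hG (h.mono hG.subset), h.grade_eq, (h.mono hG.subset).grade_eq, faceTerm,
          if_pos (Finset.card_lt_card hG)]
      have htop : faceTerm (polyA - polyB) polyB F.card F.card = 0 := by simp [faceTerm]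
      rw [chainWeight, if_neg (by rw [h.grade_eq]; omega), chainSum_pred_grade hbot, h.sum_lt,
        Finset.sum_congr rfl hterm, boolWeight_eq _ _ hpos, umbral_one_add_X_pow,
        ← Finset.sum_powerset_apply_card, Finset.ssubsets,
        Finset.sum_erase (f := fun G : Finset V => faceTerm (polyA - polyB) polyB F.card G.card) _ htop]

end IsBooleanChart

end BooleanChart

/-! ### Simplicial posets -/

section Simplicial

open Polynomial

variable {P : Type*} [PartialOrder P]

theorem IsBooleanBelow.exists_chart [OrderBot P] {x : P} {k : ℕ} (h : IsBooleanBelow x k) :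
    ∃ φ : Finset (Fin k) → P, IsBooleanChart φ Finset.univ ∧ φ Finset.univ = x := by
  obtain ⟨e⟩ := h
  have htop : (e.symm Finset.univ : P) = x := by
    refine (e.symm Finset.univ).2.2.antisymm ?_
    have : (⟨x, bot_le, le_rfl⟩ : Set.Icc ⊥ x) ≤ e.symm Finset.univ := by
      rw [e.le_symm_apply]; exact Finset.subset_univ _
    exact this
  refine ⟨fun G => e.symm G, ⟨fun G _ H _ => ?_, fun y hy => ?_⟩, htop⟩
  · rw [Subtype.coe_le_coe, e.symm.le_iff_le]
  · exact ⟨e ⟨y, bot_le, hy.trans_eq htop⟩, Finset.subset_univ _, by simp⟩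

theorem IsBooleanBelow.grade_eq [OrderBot P] [GradeMinOrder ℕ P] {x : P} {k : ℕ}
    (h : IsBooleanBelow x k) : grade ℕ x = k := by
  obtain ⟨φ, hφ, rfl⟩ := h.exists_chart
  rw [hφ.grade_eq, Finset.card_univ, Fintype.card_fin]

variable [BoundedOrder P] [GradeMinOrder ℕ P]

theorem IsSimplicialPoset.isBooleanBelow_iff (hP : IsSimplicialPoset P) {n : ℕ}
    (hrank : grade ℕ (⊤ : P) = n + 1) {x : P} {k : ℕ} (hk : k ≤ n) :
    IsBooleanBelow x k ↔ x < ⊤ ∧ grade ℕ x = k := by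
  constructor
  · intro h
    refine ⟨lt_top_iff_ne_top.2 ?_, h.grade_eq⟩
    rintro rfl
    rw [h.grade_eq] at hrank
    omega
  · rintro ⟨hx, rfl⟩
    obtain ⟨k, h⟩ := hP x hx.ne
    rwa [h.grade_eq]

variable [Fintype P]

theorem IsSimplicialPoset.rankPoly_eq (hP : IsSimplicialPoset P) {n : ℕ}
    (hrank : grade ℕ (⊤ : P) = n + 1) :
    rankPoly P = ∑ j ∈ Finset.range (n + 1), C (faceNumber P j : ℤ) * X ^ j := by
  classical
  have hmaps : ∀ x ∈ (Finset.univ.filter fun x : P => x < ⊤),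
      grade ℕ x ∈ Finset.range (n + 1) := by
    intro x hx
    have := grade_strictMono (𝕆 := ℕ) (Finset.mem_filter.1 hx).2
    simp only [Finset.mem_range]
    omega
  rw [rankPoly, ← Finset.sum_fiberwise_of_maps_to hmaps]
  refine Finset.sum_congr rfl fun j hj => ?_
  have hj : j ≤ n := Nat.lt_succ_iff.1 (Finset.mem_range.1 hj)
  have hcard : faceNumber P j = (Finset.univ.filter fun x : P => x < ⊤ ∧ grade ℕ x = j).card := by
    rw [faceNumber, ← Fintype.card_subtype, ← Nat.card_eq_fintype_card]
    exact Nat.card_congr (Equiv.subtypeEquivRight fun x => hP.isBooleanBelow_iff hrank hj)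
  rw [hcard, Finset.filter_filter, map_natCast, ← nsmul_eq_mul, ← Finset.sum_const]
  exact Finset.sum_congr rfl fun x hx => by rw [(Finset.mem_filter.1 hx).2.2]

open Classical in
theorem IsSimplicialPoset.one_add_X_pow (hP : IsSimplicialPoset P) {x : P} (hx : x < ⊤) :
    ((1 + X) ^ grade ℕ x : ℤ[X]) = ∑ y : P with y ≤ x, X ^ grade ℕ y := by
  obtain ⟨k, h⟩ := hP x hx.ne
  obtain ⟨φ, hφ, rfl⟩ := h.exists_chart
  rw [hφ.sum_le, hφ.grade_eq, add_comm, ← Finset.sum_pow_mul_eq_add_pow]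
  refine Finset.sum_congr rfl fun G hG => ?_
  rw [one_pow, mul_one, (hφ.mono (Finset.subset_univ G)).grade_eq]

theorem IsSimplicialPoset.substAB_modifiedChainPoly (hP : IsSimplicialPoset P) {n : ℕ}
    (hn : 1 ≤ n) (hrank : grade ℕ (⊤ : P) = n + 1) :
    substAB (modifiedChainPoly n P)
      = umbral (faceTerm (polyA - polyB) polyB (n + 1)) (rankPoly P)
        + umbral (faceTerm (polyA - polyB) polyB n)
            (C ((rankPoly P).eval (-1) - (-1) ^ n)) * polyB := by
  classical
  rw [_root_.substAB_modifiedChainPoly hn hrank]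
  congr 1
  · rw [rankPoly, map_sum]
    refine Finset.sum_congr rfl fun x hx => ?_
    have hx := (Finset.mem_filter.1 hx).2
    have hlt := grade_strictMono (𝕆 := ℕ) hx
    rw [hrank] at hlt
    obtain ⟨k, h⟩ := hP x hx.ne
    obtain ⟨φ, hφ, rfl⟩ := h.exists_chart
    rw [umbral_X_pow, faceTerm, if_pos hlt, hφ.chainWeight_eq, hφ.grade_eq, Nat.add_sub_cancel]
  · rw [← mul_one (C _), ← smul_eq_C_mul, ← pow_zero X, map_smul, umbral_X_pow, faceTerm,
      if_pos (by omega), boolWeight, one_mul, Nat.sub_zero, smul_mul_assoc]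

end Simplicial

/-! ### Dehn-Sommerville relations -/

section DehnSommerville

open Polynomial

theorem sum_neg_one_pow_eq_zero {α : Type*} (s : Finset α) (f : α → ℕ)
    (h : (s.filter fun x => Odd (f x)).card = (s.filter fun x => Even (f x)).card) :
    ∑ x ∈ s, (-1 : ℤ) ^ f x = 0 := by
  have hpow : ∀ x, (-1 : ℤ) ^ f x = (if Even (f x) then 1 else 0) - if Odd (f x) then 1 else 0 := by
    intro x
    rcases Nat.even_or_odd (f x) with hx | hx
    · rw [hx.neg_one_pow, if_pos hx, if_neg (Nat.not_odd_iff_even.2 hx), sub_zero]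
    · rw [hx.neg_one_pow, if_pos hx, if_neg (Nat.not_even_iff_odd.2 hx), zero_sub]
  simp only [hpow, Finset.sum_sub_distrib, Finset.sum_boole]
  rw [h, sub_self]

variable {P : Type*} [PartialOrder P] [BoundedOrder P] [GradeMinOrder ℕ P] [Fintype P]

-- The alternating sum over `[s, ⊤]` vanishes because `s ≠ ⊥`. Removing `⊤`, which contributes
-- `(-1)^(n+1)`, leaves `(-1)^n`.
open Classical in
theorem IsSemiEulerian.sum_neg_one_pow (hP : IsSemiEulerian P) {n : ℕ}
    (hrank : grade ℕ (⊤ : P) = n + 1) {s : P} (hs : s < ⊤) (hs' : s ≠ ⊥) :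
    ∑ t : P with s ≤ t ∧ t < ⊤, (-1 : ℤ) ^ grade ℕ t = (-1) ^ n := by
  have h0 : ∑ t ∈ (Finset.univ.filter fun t : P => s ≤ t), (-1 : ℤ) ^ grade ℕ t = 0 := by
    refine sum_neg_one_pow_eq_zero _ _ ?_
    have h := hP s ⊤ hs fun h => hs' h.1
    rw [Nat.card_eq_fintype_card, Nat.card_eq_fintype_card, Fintype.card_subtype,
      Fintype.card_subtype] at h
    simpa [Finset.filter_filter] using h
  have h1 : (Finset.univ.filter fun t : P => s ≤ t)
      = insert ⊤ (Finset.univ.filter fun t : P => s ≤ t ∧ t < ⊤) := by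
    ext t
    simp only [Finset.mem_filter, Finset.mem_univ, true_and, Finset.mem_insert]
    constructor
    · exact fun h => (eq_or_ne t ⊤).imp id fun h' => ⟨h, lt_top_iff_ne_top.2 h'⟩
    · rintro (rfl | h)
      exacts [le_top, h.1]
  rw [h1, Finset.sum_insert (by simp), hrank, pow_succ] at h0
  linarith

/-- Expand each `(1 + X) ^ rk t` over the elements `s ≤ t` and exchange the sums. The inner
alternating sum over `s ≤ t < ⊤` is `(-1)^n` for `s ≠ ⊥`, and `F(-1)` for `s = ⊥`; the latter
accounts for the constant. -/
theorem IsSimplicialPoset.dehnSommerville (hP : IsSimplicialPoset P) (hE : IsSemiEulerian P)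
    {n : ℕ} (hrank : grade ℕ (⊤ : P) = n + 1) :
    (rankPoly P).comp (-1 - X)
      = (-1) ^ n * rankPoly P + C ((rankPoly P).eval (-1) - (-1) ^ n) := by
  classical
  have htop : (⊥ : P) < ⊤ := by
    refine bot_lt_iff_ne_bot.2 fun h => ?_
    rw [h, grade_bot] at hrank
    exact absurd hrank (by simp)
  have h1 : (rankPoly P).comp (-1 - X)
      = ∑ s : P with s < ⊤, (∑ t : P with s ≤ t ∧ t < ⊤, C ((-1 : ℤ) ^ grade ℕ t))
          * X ^ grade ℕ s := by
    calc (rankPoly P).comp (-1 - X)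
        = ∑ t : P with t < ⊤, ∑ s : P with s ≤ t, C ((-1 : ℤ) ^ grade ℕ t) * X ^ grade ℕ s := by
          rw [rankPoly, Polynomial.sum_comp]
          refine Finset.sum_congr rfl fun t ht => ?_
          rw [← Finset.mul_sum, ← hP.one_add_X_pow (Finset.mem_filter.1 ht).2, X_pow_comp, map_pow,
            ← mul_pow]
          congr 1
          rw [map_neg, map_one]
          ring
      _ = _ := by
          simp only [Finset.sum_mul]
          refine Finset.sum_comm' fun t s => ?_
          simp only [Finset.mem_filter, Finset.mem_univ, true_and]
          exact ⟨fun h => ⟨⟨h.2, h.1⟩, h.2.trans_lt h.1⟩, fun h => ⟨h.1.2, h.1.1⟩⟩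
  have h2 : ∀ s ∈ (Finset.univ.filter fun s : P => s < ⊤),
      (∑ t : P with s ≤ t ∧ t < ⊤, C ((-1 : ℤ) ^ grade ℕ t)) * X ^ grade ℕ s
        = (-1) ^ n * X ^ grade ℕ s
          + if s = ⊥ then C ((rankPoly P).eval (-1) - (-1) ^ n) else 0 := by
    intro s hs
    rw [← map_sum]
    split_ifs with h
    · subst h
      rw [grade_bot, Nat.bot_eq_zero, pow_zero, mul_one, mul_one, rankPoly, eval_finsetSum, map_sub,
        map_pow (C : ℤ →+* ℤ[X]), map_neg, map_one]
      simp
    · rw [hE.sum_neg_one_pow hrank (Finset.mem_filter.1 hs).2 h]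
      simp
  rw [h1, Finset.sum_congr rfl h2, Finset.sum_add_distrib, Finset.sum_ite_eq',
    if_pos (by simpa using htop), ← Finset.mul_sum, rankPoly]

theorem rankPoly_eval_zero (h : (⊥ : P) < ⊤) : (rankPoly P).eval 0 = 1 := by
  classical
  rw [rankPoly, eval_finsetSum]
  simp only [eval_pow, eval_X]
  rw [Finset.sum_eq_single ⊥]
  · simp
  · intro s _ hs
    have := grade_strictMono (𝕆 := ℕ) (bot_lt_iff_ne_bot.2 hs)
    exact zero_pow (by omega)
  · intro h'
    exact absurd h (by simpa using h')

/-- Evaluating Dehn-Sommerville at `-1`, where `F(0) = 1`, forces the defect to be zero for even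
`n`; for odd `n` the claim is trivial. -/
theorem IsSimplicialPoset.eulerDefect_eq (hP : IsSimplicialPoset P) (hE : IsSemiEulerian P)
    {n : ℕ} (hrank : grade ℕ (⊤ : P) = n + 1) :
    (-1) ^ n * ((rankPoly P).eval (-1) - (-1) ^ n) = -((rankPoly P).eval (-1) - (-1) ^ n) := by
  have h := congrArg (Polynomial.eval (-1)) (hP.dehnSommerville hE hrank)
  have h0 : (rankPoly P).eval 0 = 1 := by
    refine rankPoly_eval_zero (bot_lt_iff_ne_bot.2 fun h => ?_)
    rw [h, grade_bot] at hrank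
    exact absurd hrank (by simp)
  simp [eval_comp, h0] at h
  rcases neg_one_pow_eq_or ℤ n with hn | hn <;> rw [hn] at h ⊢ <;> linarith

end DehnSommerville

/-! ### The h-vector as a change of basis -/

section HVector

open Polynomial

theorem sum_coeff_X_sub_one_pow {R : Type*} [CommRing R] (x y : R) {n N : ℕ} (h : N ≤ n) :
    ∑ i ∈ Finset.range (n + 1), (((X - 1) ^ N : ℤ[X]).coeff (n - i) : R) * (x ^ (n - i) * y ^ i)
      = (x - y) ^ N * y ^ (n - N) := by
  rw [← Finset.sum_range_reflect]
  simp only [Nat.add_sub_cancel]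
  have hc : ∀ k, ((X - 1) ^ N : ℤ[X]).coeff k = (-1) ^ (N - k) * N.choose k := by
    intro k
    have := coeff_X_add_C_pow (-1 : ℤ) N k
    rwa [map_neg, map_one, ← sub_eq_add_neg] at this
  have hsub : Finset.range (N + 1) ⊆ Finset.range (n + 1) :=
    Finset.range_subset_range.2 (by omega)
  rw [← Finset.sum_subset hsub, sub_eq_add_neg x y, add_pow, Finset.sum_mul]
  · refine Finset.sum_congr rfl fun k hk => ?_
    have hk : k ≤ N := Nat.lt_succ_iff.1 (Finset.mem_range.1 hk)
    rw [show n - (n - k) = k by omega, hc,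
      show n - k = (N - k) + (n - N) by omega, pow_add, neg_pow y]
    push_cast
    ring
  · intro k hk hk'
    have hk := Finset.mem_range.1 hk
    have hk' : ¬ k < N + 1 := fun h => hk' (Finset.mem_range.2 h)
    rw [show n - (n - k) = k by omega, hc, Nat.choose_eq_zero_of_lt (by omega)]
    simp

/-- The defining identity made homogeneous of degree `n`. It is needed at `(1 + X, X)`, where `x - y
= 1`, and at `(X, 1 + X)`, where `x - y = -1`. -/
theorem sum_hNumber {P : Type*} [PartialOrder P] [OrderBot P] (n : ℕ) {R : Type*} [CommRing R]
    (x y : R) :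
    ∑ i ∈ Finset.range (n + 1), (hNumber n P i : R) * (x ^ (n - i) * y ^ i)
      = ∑ j ∈ Finset.range (n + 1), (faceNumber P j : R) * ((x - y) ^ (n - j) * y ^ j) := by
  have h : ∀ i, (hNumber n P i : R) = ∑ j ∈ Finset.range (n + 1),
      (faceNumber P j : R) * (((X - 1) ^ (n - j) : ℤ[X]).coeff (n - i) : R) := by
    intro i
    rw [hNumber, finsetSum_coeff]
    simp only [coeff_C_mul]
    push_cast
    rfl
  simp only [h, Finset.sum_mul]
  rw [Finset.sum_comm]
  refine Finset.sum_congr rfl fun j hj => ?_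
  have hj : j ≤ n := Nat.lt_succ_iff.1 (Finset.mem_range.1 hj)
  simp only [mul_assoc]
  rw [← Finset.mul_sum, sum_coeff_X_sub_one_pow x y (Nat.sub_le n j), Nat.sub_sub_self hj]

end HVector

/-! ### Elements of the semisuspension -/

section SemisuspensionPoset

open Polynomial Semisuspension

variable {V : Type*} {n : ℕ} {i : Fin n}

/-- The face of the semisuspension with a given vertex set, and the greatest element if there is
none. -/
noncomputable def Semisuspension.ofFinset (Γ : LowerSet (Finset V)) (F : Finset V) : Semisuspension Γ :=
  open Classical in if h : F ∈ Γ then face F h else top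

theorem Semisuspension.ofFinset_of_mem {Γ : LowerSet (Finset V)} {F : Finset V} (h : F ∈ Γ) :
    ofFinset Γ F = face F h := dif_pos h

theorem LambdaPoset.boundary_le {F : Finset (Fin (n + 1))}
    (hF : F ∈ boundaryComplex (partialShelling n i)) : F ∈ partialShelling n i := by
  obtain ⟨j, k, hj, -, hjF, -⟩ := mem_boundary_partialShelling.1 hF
  exact mem_partialShelling.2 ⟨j, hj, hjF⟩

noncomputable instance : Fintype (LambdaPoset n i) := Fintype.ofFinite _

/-- Neither the new cell nor the top lies below a face, and the default value of `ofFinset` is never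
met, since subsets of `F` are faces. -/
theorem LambdaPoset.isBooleanChart {F : Finset (Fin (n + 1))} (hF : F ∈ partialShelling n i) :
    IsBooleanChart (ofFinset (partialShelling n i)) F where
  le_iff G hG H hH := by
    rw [ofFinset_of_mem ((partialShelling n i).lower hG hF),
      ofFinset_of_mem ((partialShelling n i).lower hH hF), face_le_face]
  exists_eq y hy := by
    rw [ofFinset_of_mem hF] at hy
    cases y with
    | face G hG => exact ⟨G, hy, ofFinset_of_mem hG⟩
    | cell => exact (not_cell_le_face hy).elim
    | top => exact (not_top_le_face hy).elim

theorem LambdaPoset.ofFinset_injOn :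
    Set.InjOn (ofFinset (partialShelling n i)) {F | F ∈ partialShelling n i} := by
  intro F hF G hG h
  rw [ofFinset_of_mem hF, ofFinset_of_mem hG] at h
  injection h

open Classical in
theorem LambdaPoset.sum_lt_cell {M : Type*} [AddCommMonoid M] (g : LambdaPoset n i → M) :
    ∑ x : LambdaPoset n i with x < cell, g x
      = ∑ F with F ∈ boundaryComplex (partialShelling n i), g (ofFinset _ F) := by
  refine (Finset.sum_nbij (ofFinset _) ?_ ?_ ?_ fun _ _ => rfl).symm
  · intro F hF
    have hF := (Finset.mem_filter.1 hF).2
    rw [ofFinset_of_mem (boundary_le hF)]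
    simpa using face_lt_cell.2 hF
  · exact ofFinset_injOn.mono fun F hF => boundary_le (Finset.mem_filter.1 hF).2
  · intro x hx
    have hx : x < cell := (Finset.mem_filter.1 hx).2
    cases x with
    | face F hF => exact ⟨F, by simpa using face_lt_cell.1 hx, ofFinset_of_mem hF⟩
    | cell => exact (lt_irrefl _ hx).elim
    | top => exact (not_top_le_cell hx.le).elim

open Classical in
theorem LambdaPoset.sum_lt_top {M : Type*} [AddCommMonoid M] (g : LambdaPoset n i → M) :
    ∑ x : LambdaPoset n i with x < ⊤, g x
      = g cell + ∑ F with F ∈ partialShelling n i, g (ofFinset _ F) := by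
  have h : (Finset.univ.filter fun x : LambdaPoset n i => x < ⊤)
      = insert cell ((Finset.univ.filter fun F => F ∈ partialShelling n i).image
          (ofFinset (partialShelling n i))) := by
    ext x
    simp only [Finset.mem_filter, Finset.mem_univ, true_and, Finset.mem_insert, Finset.mem_image]
    constructor
    · intro hx
      cases x with
      | face F hF => exact Or.inr ⟨F, hF, ofFinset_of_mem hF⟩
      | cell => exact Or.inl rfl
      | top => exact (lt_irrefl _ hx).elim
    · rintro (rfl | ⟨F, hF, rfl⟩)
      · exact cell_lt_top
      · rw [ofFinset_of_mem hF]; exact face_lt_top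
  rw [h, Finset.sum_insert, Finset.sum_image]
  · exact ofFinset_injOn.mono fun F hF => (Finset.mem_filter.1 hF).2
  · rw [Finset.mem_image]
    rintro ⟨F, hF, h⟩
    rw [ofFinset_of_mem (Finset.mem_filter.1 hF).2] at h
    cases h

end SemisuspensionPoset

/-! ### Generating polynomials of `Γ^n_i` and its boundary -/

section FacePolynomials

open Polynomial

theorem sum_superset_X_pow {V : Type*} [Fintype V] [DecidableEq V] (A : Finset V) :
    ∑ F : Finset V with A ⊆ F, (X ^ F.card : ℤ[X])
      = X ^ A.card * (1 + X) ^ (Fintype.card V - A.card) := by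
  have h : (Finset.univ.filter fun F : Finset V => A ⊆ F) = Finset.Icc A Finset.univ := by
    ext F; simp
  rw [h, Finset.Icc_eq_image_powerset (Finset.subset_univ A), Finset.sum_image]
  · have hc : (Finset.univ \ A).card = Fintype.card V - A.card := by
      rw [Finset.card_sdiff_of_subset (Finset.subset_univ A), Finset.card_univ]
    rw [← hc, add_comm 1, ← Finset.sum_pow_mul_eq_add_pow, Finset.mul_sum]
    refine Finset.sum_congr rfl fun F hF => ?_
    have hd : Disjoint A F := Finset.disjoint_of_subset_right (Finset.mem_powerset.1 hF)
      Finset.disjoint_sdiff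
    rw [Finset.card_union_of_disjoint hd, pow_add, one_pow, mul_one]
  · intro F hF G hG h
    have hd : ∀ F ∈ ((Finset.univ \ A).powerset : Set (Finset V)), (A ∪ F) \ A = F := by
      intro F hF
      have hd : Disjoint A F := Finset.disjoint_of_subset_right
        (Finset.mem_powerset.1 (Finset.mem_coe.1 hF)) Finset.disjoint_sdiff
      rw [Finset.union_sdiff_left, Finset.sdiff_eq_self_of_disjoint hd.symm]
    rw [← hd F hF, ← hd G hG]
    exact congrArg (· \ A) h

variable {n : ℕ} {i : Fin n}

-- The faces are the vertex sets that do not contain all of `0, …, i`.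
open Classical in
theorem sum_partialShelling :
    ∑ F with F ∈ partialShelling n i, (X ^ F.card : ℤ[X])
      = (1 + X) ^ (n + 1) - X ^ ((i : ℕ) + 1) * (1 + X) ^ (n - i) := by
  have h : (Finset.univ.filter fun F => F ∈ partialShelling n i)
      = Finset.univ.filter fun F => ¬ Finset.Iic i.castSucc ⊆ F := by
    refine Finset.filter_congr fun F _ => ?_
    rw [mem_partialShelling, Finset.not_subset]
    simp [Fin.le_def]
  have h1 := Finset.sum_filter_add_sum_filter_not Finset.univ
    (fun F : Finset (Fin (n + 1)) => Finset.Iic i.castSucc ⊆ F) fun F => (X ^ F.card : ℤ[X])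
  have h2 := sum_superset_X_pow (∅ : Finset (Fin (n + 1)))
  have h3 := sum_superset_X_pow (Finset.Iic i.castSucc)
  simp only [Finset.empty_subset, Finset.filter_true, Finset.card_empty, pow_zero, one_mul,
    Fintype.card_fin, Nat.sub_zero] at h2
  simp only [Fin.card_Iic, Fin.val_castSucc, Fintype.card_fin, Nat.add_sub_add_right] at h3
  rw [h2] at h1
  rw [h, ← h1, ← h3]
  simp

-- Inclusion-exclusion: discard the sets containing all of `0, …, i` and those containing all of
-- `i+1, …, n`. Only the full vertex set is discarded twice, and `X^(n+1)` restores it.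
open Classical in
theorem sum_boundaryComplex :
    ∑ F with F ∈ boundaryComplex (partialShelling n i), (X ^ F.card : ℤ[X])
      = (1 + X) ^ (n + 1) - X ^ ((i : ℕ) + 1) * (1 + X) ^ (n - i)
        - X ^ (n - i) * (1 + X) ^ ((i : ℕ) + 1) + X ^ (n + 1) := by
  have h : (Finset.univ.filter fun F => F ∈ boundaryComplex (partialShelling n i))
      = (Finset.univ.filter fun F => F ∈ partialShelling n i).filter
          fun F => ¬ Finset.Ioi i.castSucc ⊆ F := by
    ext F
    simp only [Finset.mem_filter, Finset.mem_univ, true_and, mem_boundary_partialShelling,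
      mem_partialShelling, Finset.not_subset, Finset.mem_Ioi, Fin.lt_def, Fin.val_castSucc]
    constructor
    · rintro ⟨j, k, hj, hk, hjF, hkF⟩
      exact ⟨⟨j, hj, hjF⟩, k, hk, hkF⟩
    · rintro ⟨⟨j, hj, hjF⟩, k, hk, hkF⟩
      exact ⟨j, k, hj, hk, hjF, hkF⟩
  have h' : ((Finset.univ.filter fun F => F ∈ partialShelling n i).filter
      fun F => Finset.Ioi i.castSucc ⊆ F)
        = (Finset.univ.filter fun F => Finset.Ioi i.castSucc ⊆ F).erase Finset.univ := by
    ext F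
    simp only [Finset.mem_filter, Finset.mem_univ, true_and, mem_partialShelling,
      Finset.mem_erase]
    refine and_comm.trans (and_comm.trans (and_congr_left fun hF => ?_))
    rw [← not_iff_not]
    push Not
    constructor
    · intro h
      refine Finset.eq_univ_iff_forall.2 fun j => ?_
      rcases le_or_gt (j : ℕ) i with hj | hj
      · exact h j hj
      · exact hF (Finset.mem_Ioi.2 hj)
    · rintro rfl j _
      exact Finset.mem_univ j
  have h1 := Finset.sum_filter_add_sum_filter_not
    (Finset.univ.filter fun F => F ∈ partialShelling n i)
    (fun F : Finset (Fin (n + 1)) => Finset.Ioi i.castSucc ⊆ F) fun F => (X ^ F.card : ℤ[X])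
  have h2 := sum_superset_X_pow (Finset.Ioi i.castSucc)
  rw [← Finset.add_sum_erase _ _ (a := Finset.univ) (by simp)] at h2
  simp only [Fin.card_Ioi, Fin.val_castSucc, Fintype.card_fin, Finset.card_univ] at h2
  rw [h', sum_partialShelling, ← h] at h1
  have hi := i.2
  rw [show n + 1 - 1 - (i : ℕ) = n - i by omega, show n + 1 - (n - i) = (i : ℕ) + 1 by omega] at h2
  rw [← h1]
  linear_combination -h2

end FacePolynomials

/-! ### The ab-polynomials of the semisuspensions -/

section LambdaChain

open Polynomial Semisuspension

variable {n : ℕ} {i : Fin n}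

theorem LambdaPoset.rankPoly_eq :
    rankPoly (LambdaPoset n i)
      = X ^ n + ((1 + X) ^ (n + 1) - X ^ ((i : ℕ) + 1) * (1 + X) ^ (n - i)) := by
  classical
  rw [rankPoly, sum_lt_top, ← sum_partialShelling]
  congr 1
  refine Finset.sum_congr rfl fun F hF => ?_
  rw [(isBooleanChart (Finset.mem_filter.1 hF).2).grade_eq]

theorem LambdaPoset.chainWeight_cell :
    chainWeight (cell : LambdaPoset n i)
      = umbral (faceTerm (polyA - polyB) polyB n) ((1 + X) ^ (n + 1)
          - X ^ ((i : ℕ) + 1) * (1 + X) ^ (n - i) - X ^ (n - i) * (1 + X) ^ ((i : ℕ) + 1)) * polyB := by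
  classical
  have hg : grade ℕ (cell : LambdaPoset n i) = n := rfl
  have hn := i.pos
  have hbot : ⊥ < (cell : LambdaPoset n i) := face_lt_cell.2 empty_mem_boundary
  rw [chainWeight, hg, if_neg hn.ne']
  have h := chainSum_pred_grade hbot
  rw [hg] at h
  rw [h, sum_lt_cell]
  congr 1
  -- The term `X^(n+1)` of the boundary polynomial lies beyond the cutoff of `faceTerm`, so it can
  -- be added freely.
  have h1 : umbral (faceTerm (polyA - polyB) polyB n) (X ^ (n + 1)) = 0 := by
    rw [umbral_X_pow, faceTerm, if_neg (by omega)]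
  rw [← add_zero (umbral _ _), ← h1, ← map_add, ← sum_boundaryComplex, map_sum]
  refine Finset.sum_congr rfl fun F hF => ?_
  have hF := (Finset.mem_filter.1 hF).2
  have hc := isBooleanChart (boundary_le hF)
  rw [umbral_X_pow, faceTerm, if_pos (card_lt_of_mem_boundary hF), hc.chainWeight_eq, hc.grade_eq]

/-- The `ab`-polynomial of the semisuspension `Λ^n_i`. -/
theorem LambdaPoset.substAB_modifiedChainPoly :
    substAB (modifiedChainPoly n (LambdaPoset n i))
      = umbral (faceTerm (polyA - polyB) polyB (n + 1))
          ((1 + X) ^ (n + 1) - X ^ ((i : ℕ) + 1) * (1 + X) ^ (n - i))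
        + umbral (faceTerm (polyA - polyB) polyB n) ((1 + X) ^ (n + 1)
          - X ^ ((i : ℕ) + 1) * (1 + X) ^ (n - i) - X ^ (n - i) * (1 + X) ^ ((i : ℕ) + 1)) * polyB := by
  classical
  -- Since `i < n`, both powers of `1 + X` vanish at `-1` and only `X^n`, from the new cell,
  -- survives. So no Euler correction occurs.
  have h0 : (rankPoly (LambdaPoset n i)).eval (-1) - (-1) ^ n = 0 := by
    have hi : n - (i : ℕ) ≠ 0 := by have := i.2; omega
    rw [rankPoly_eq]
    simp [hi]
  rw [_root_.substAB_modifiedChainPoly (Nat.one_le_iff_ne_zero.2 i.pos.ne') grade_top_eq, h0,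
    zero_smul, add_zero, sum_lt_top, chainWeight_cell, add_comm]
  congr 1
  · rw [← sum_partialShelling, map_sum]
    refine Finset.sum_congr rfl fun F hF => ?_
    have hF := (Finset.mem_filter.1 hF).2
    have hc := isBooleanChart hF
    rw [umbral_X_pow, faceTerm, if_pos (Nat.lt_succ_of_le (card_le_of_mem hF)), hc.chainWeight_eq,
      hc.grade_eq, Nat.add_sub_cancel]
  · rw [show grade ℕ (cell : LambdaPoset n i) = n from rfl, Nat.sub_self, pow_zero, mul_one]

theorem LambdaPoset.substAB_modifiedChainPoly_zero (hn : 0 < n) :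
    substAB (modifiedChainPoly n (LambdaPoset n ⟨0, hn⟩)) = checkPsi polyA polyB n 0 := by
  rw [substAB_modifiedChainPoly, checkPsi_eq _ _ hn (Nat.zero_le n), add_sub_assoc,
    ← sub_mul, ← map_sub]
  have h1 : umbral (faceTerm (polyA - polyB) polyB n) (X ^ (n + 1)) = 0 := by
    rw [umbral_X_pow, faceTerm, if_neg (by omega)]
  rw [← add_zero (umbral (faceTerm (polyA - polyB) polyB n) _), ← h1, ← map_add]
  congr 3 <;> simp <;> ring

/-- With `i = j + 1`, the face polynomials of `Γ^n_i` and `Γ^n_j` differ by `X^i (1+X)^(n-i)`, and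
the boundary polynomials by this minus `X^(n-i) (1+X)^i`. -/
theorem LambdaPoset.substAB_modifiedChainPoly_succ {j : ℕ} (hj : j + 1 < n) :
    substAB (modifiedChainPoly n (LambdaPoset n ⟨j + 1, hj⟩))
      - substAB (modifiedChainPoly n (LambdaPoset n ⟨j, Nat.lt_of_succ_lt hj⟩))
      = checkPsi polyA polyB n (j + 1) := by
  rw [substAB_modifiedChainPoly, substAB_modifiedChainPoly,
    checkPsi_eq _ _ (Nat.zero_lt_of_lt hj) hj.le, add_sub_add_comm, ← sub_mul, ← map_sub, ← map_sub,
    add_sub_assoc, ← sub_mul, ← map_sub]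
  obtain ⟨k, rfl⟩ := Nat.exists_eq_add_of_lt hj
  have e1 : j + 1 + k + 1 - (j + 1) = k + 1 := by omega
  have e2 : j + 1 + k + 1 - j = k + 2 := by omega
  simp only [e1, e2]
  congr 3 <;> ring

end LambdaChain

/-! ### Existence of the cd-indices and the h-vector formula -/

section Main

open Polynomial

theorem exists_substCD_eq_checkPsi {n i : ℕ} (hn : 0 < n) (hi : i ≤ n) :
    ∃ Φ, substCD Φ = checkPsi polyA polyB n i := by
  have hc : polyA + polyB ∈ substCD.toRingHom.range :=
    ⟨FreeAlgebra.ι ℤ CDVar.c, by simp [substCD]⟩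
  have hd : polyA * polyB + polyB * polyA ∈ substCD.toRingHom.range :=
    ⟨FreeAlgebra.ι ℤ CDVar.d, by simp [substCD]⟩
  exact (checkPsi_mem hc hd hn).2 i hi

theorem existsUnique_isCDIndex {n : ℕ} {P : Type*} [PartialOrder P] [GradeMinOrder ℕ P]
    (h : ∃ Φ, substCD Φ = substAB (modifiedChainPoly n P)) : ∃! Φ, IsCDIndex n P Φ := by
  obtain ⟨Φ, hΦ⟩ := h
  exact ⟨Φ, hΦ, fun Ψ hΨ => substCD_injective (hΨ.trans hΦ.symm)⟩

theorem substCD_cdIndex {n : ℕ} {P : Type*} [PartialOrder P] [GradeMinOrder ℕ P]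
    (h : ∃! Φ, IsCDIndex n P Φ) : substCD (cdIndex n P) = substAB (modifiedChainPoly n P) := by
  rw [cdIndex, dif_pos h.exists]
  exact h.exists.choose_spec

theorem LambdaPoset.existsUnique_isCDIndex {n : ℕ} (i : Fin n) :
    ∃! Φ, IsCDIndex n (LambdaPoset n i) Φ := by
  obtain ⟨i, hi⟩ := i
  induction i with
  | zero =>
    refine _root_.existsUnique_isCDIndex ?_
    rw [substAB_modifiedChainPoly_zero hi]
    exact exists_substCD_eq_checkPsi hi (Nat.zero_le n)
  | succ i ih =>
    refine _root_.existsUnique_isCDIndex ?_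
    obtain ⟨Φ, hΦ, -⟩ := ih (Nat.lt_of_succ_lt hi)
    obtain ⟨Ψ, hΨ⟩ := exists_substCD_eq_checkPsi (Nat.zero_lt_of_lt hi) hi.le
    refine ⟨Ψ + Φ, ?_⟩
    rw [map_add, hΨ, hΦ, ← substAB_modifiedChainPoly_succ hi, sub_add_cancel]

theorem substCD_checkPhi {n i : ℕ} (hi : i < n) :
    substCD (checkPhi n i) = checkPsi polyA polyB n i := by
  cases i with
  | zero =>
    rw [checkPhi, dif_pos hi, substCD_cdIndex (LambdaPoset.existsUnique_isCDIndex _),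
      LambdaPoset.substAB_modifiedChainPoly_zero]
  | succ i =>
    rw [checkPhi, dif_pos hi, map_sub, substCD_cdIndex (LambdaPoset.existsUnique_isCDIndex _),
      substCD_cdIndex (LambdaPoset.existsUnique_isCDIndex _),
      LambdaPoset.substAB_modifiedChainPoly_succ]

/-- Summing `checkPsi_eq` against the h-numbers yields `L_{n+1}(F) + L_n(F) b - L_n(F - e) b`, in
which only `L_n(e) b` survives beside the first term. -/
theorem IsSimplicialPoset.substAB_modifiedChainPoly_eq_sum {P : Type*} [PartialOrder P]
    [BoundedOrder P] [GradeMinOrder ℕ P] [Fintype P] (hP : IsSimplicialPoset P)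
    (hE : IsSemiEulerian P) {n : ℕ} (hn : 1 ≤ n) (hrank : grade ℕ (⊤ : P) = n + 1) :
    substAB (modifiedChainPoly n P)
      = ∑ i ∈ Finset.range n, hNumber n P i • checkPsi polyA polyB n i := by
  have hF := hP.rankPoly_eq hrank
  have h1 : ∑ i ∈ Finset.range (n + 1), hNumber n P i • (X ^ i * (1 + X) ^ (n - i) : ℤ[X])
      = rankPoly P := by
    have h := sum_hNumber (P := P) n (1 + X : ℤ[X]) X
    rw [hF]
    simp only [add_sub_cancel_right, one_pow, one_mul] at h
    simpa [zsmul_eq_mul, mul_comm] using h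
  have h2 : ∑ i ∈ Finset.range (n + 1), hNumber n P i • (X ^ (n - i) * (1 + X) ^ i : ℤ[X])
      = rankPoly P - C ((rankPoly P).eval (-1) - (-1) ^ n) := by
    have h := sum_hNumber (P := P) n (X : ℤ[X]) (1 + X)
    have h3 : (-1) ^ n * (rankPoly P).comp (-1 - X)
        = ∑ i ∈ Finset.range (n + 1), hNumber n P i • (X ^ (n - i) * (1 + X) ^ i : ℤ[X]) := by
      simp only [zsmul_eq_mul]
      rw [h, hF, Polynomial.comp, eval₂_finsetSum, Finset.mul_sum]
      refine Finset.sum_congr rfl fun j hj => ?_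
      have hj : j ≤ n := Nat.lt_succ_iff.1 (Finset.mem_range.1 hj)
      obtain ⟨k, rfl⟩ := Nat.exists_eq_add_of_le hj
      have hs : ((-1 : ℤ[X]) ^ j) * (-1) ^ j = 1 := by rw [← mul_pow]; simp
      rw [show (-1 - X : ℤ[X]) = -1 * (1 + X) by ring, show (X - (1 + X) : ℤ[X]) = -1 by ring]
      simp only [eval₂_mul, eval₂_pow, eval₂_X, eval₂_C, Nat.add_sub_cancel_left, pow_add, mul_pow]
      simp only [map_natCast]
      linear_combination ((faceNumber P j : ℤ[X]) * (-1) ^ k * (1 + X) ^ j) * hs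
    -- Multiplying Dehn-Sommerville by `(-1)^n` leaves the constant `(-1)^n e`, which is `-e`.
    have h4 := congrArg (C : ℤ → ℤ[X]) (hP.eulerDefect_eq hE hrank)
    have hs : ((-1 : ℤ[X]) ^ n) * (-1) ^ n = 1 := by rw [← mul_pow]; simp
    rw [← h3, hP.dehnSommerville hE hrank]
    rw [map_mul, map_neg, map_pow, map_neg, map_one] at h4
    linear_combination rankPoly P * hs + h4
  have h3 : ∀ i ∈ Finset.range (n + 1), hNumber n P i • checkPsi polyA polyB n i
      = umbral (faceTerm (polyA - polyB) polyB (n + 1))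
          (hNumber n P i • (X ^ i * (1 + X) ^ (n - i)))
        + umbral (faceTerm (polyA - polyB) polyB n)
          (hNumber n P i • (X ^ i * (1 + X) ^ (n - i))) * polyB
        - umbral (faceTerm (polyA - polyB) polyB n)
          (hNumber n P i • (X ^ (n - i) * (1 + X) ^ i)) * polyB := by
    intro i hi
    rw [checkPsi_eq _ _ hn (Nat.lt_succ_iff.1 (Finset.mem_range.1 hi))]
    simp only [map_zsmul, smul_sub, smul_add, smul_mul_assoc]
  -- The vanishing term `i = n` is appended, because `h1` and `h2` involve the whole h-vector.
  rw [← add_zero (∑ i ∈ Finset.range n, _), ← smul_zero (hNumber n P n),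
    ← checkPsi_self polyA polyB n, ← Finset.sum_range_succ, Finset.sum_congr rfl h3,
    Finset.sum_sub_distrib, Finset.sum_add_distrib, ← Finset.sum_mul, ← Finset.sum_mul, ← map_sum,
    ← map_sum, ← map_sum, h1, h2, map_sub, sub_mul, hP.substAB_modifiedChainPoly hn hrank]
  abel

end Main

theorem mainTheorem3 {P : Type*} [PartialOrder P] [BoundedOrder P] [Finite P] [GradeMinOrder ℕ P]
    (n : ℕ) (hn : 1 ≤ n) (hrank : grade ℕ (⊤ : P) = n + 1)
    (hSE : IsSemiEulerian P) (hsimp : IsSimplicialPoset P) :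
    (∃! Φ : CDPoly, IsCDIndex n P Φ) ∧
    (∀ i : Fin n, ∃! Φ : CDPoly, IsCDIndex n (LambdaPoset n i) Φ) ∧
    cdIndex n P = ∑ i ∈ Finset.range n, hNumber n P i • checkPhi n i := by
  have := Fintype.ofFinite P
  -- The right-hand side is itself a cd-index of `P`, so existence and the formula come together.
  have h : substCD (∑ i ∈ Finset.range n, hNumber n P i • checkPhi n i)
      = substAB (modifiedChainPoly n P) := by
    rw [hsimp.substAB_modifiedChainPoly_eq_sum hSE hn hrank, map_sum]
    refine Finset.sum_congr rfl fun i hi => ?_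
    rw [map_zsmul, substCD_checkPhi (Finset.mem_range.1 hi)]
  have hP : ∃! Φ : CDPoly, IsCDIndex n P Φ := existsUnique_isCDIndex ⟨_, h⟩
  exact ⟨hP, LambdaPoset.existsUnique_isCDIndex,
    substCD_injective ((substCD_cdIndex hP).trans h.symm)⟩
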